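/- Let $(X,\Sigma,\mu)$ be a non-atomic probability space and let $(T_y)_{y\in\mathbb Z^d}$ be a measure-preserving action of $\mathbb Z^d$ on $X$ which is free, in the sense that for every $y\neq 0$ every measurable set of positive measure contains a measurable set $B$ of positive measure with $\mu(B\cap T_{-y}B)=0$. (If $X$ is a standard Borel space, or merely countably separated, this says that $T_yx\neq x$ for $\mu$-a.e. $x$, for each $y\ne0$.) Let $(E_m)_{m\ge 0}$ be an arbitrary sequence of finite non-empty subsets of $\mathbb Z^d$, and for real- or complex-valued $f$ put $$M_mf(x)=\frac1{|E_m|}\sum_{y\in E_m}f(T_{-y}x),\qquad Sf(x)=\Big(\sum_{m}|M_mf(x)-M_{m+1}f(x)|^2\Big)^{1/2}\in[0,\infty].$$ For functions $f$ on $\mathbb Z^d$ put similarly $$A_mf(n)=\frac1{|E_m|}\sum_{y\in E_m}f(n-y),\qquad \mathcal Sf(n)=\Big(\sum_m|A_mf(n)-A_{m+1}f(n)|^2\Big)^{1/2}.$$ Write $\|g\|_{L^{p,\infty}(\mu)}=\sup_{\lambda\ge 0}\lambda\,\mu(\{|g|>\lambda\})^{1/p}$, and use counting measure on $\mathbb Z^d$.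 Then: 1. For every $1\le p\le 2$ the following are equivalent: (i) for each $f\in L^p(X,\mu)$, $Sf<\infty$ $\mu$-a.e.; (ii) there is a constant $C<\infty$ such that $\|Sf\|_{L^{p,\infty}(X)}\le C\|f\|_{L^p(X)}$ for all $f\in L^p(X,\mu)$. 2. For every constant $0\le C<\infty$, one has $\|Sf\|_{L^{1,\infty}(X)}\le C\|f\|_{L^1(X)}$ for all $f\in L^1(X,\mu)$ if and only if $\|\mathcal Sf\|_{L^{1,\infty}(\mathbb Z^d)}\le C\|f\|_{L^1(\mathbb Z^d)}$ for all $f\in L^1(\mathbb Z^d)$. In particular, for $p=1$, (i) and (ii) are also equivalent to the weak-type $(1,1)$ bound for $\mathcal S$. -/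

import Mathlib

open MeasureTheory
open scoped ENNReal NNReal

section Dynamics

variable {d : ℕ} {X : Type*} {𝕜 : Type*}

/-- `μ` is non-atomic: every measurable set of positive measure contains a measurable subset of
strictly smaller positive measure. (If `X` carries a `σ`-algebra without measurable singletons, this
is stronger than asking that points have measure zero.) -/
def IsNonatomicMeasure [MeasurableSpace X] (μ : Measure X) : Prop :=
  ∀ A : Set X, MeasurableSet A → 0 < μ A →
    ∃ B ⊆ A, MeasurableSet B ∧ 0 < μ B ∧ μ B < μ A

/-- The action `T` of `ℤ^d` on the measure space `(X, μ)` is free: for each `y ≠ 0`, every measurable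
set of positive measure contains a measurable set `B` of positive measure such that `B` and
`T_{-y} B` are disjoint up to a null set. On a countably separated space, in particular on a standard
Borel space, this says that `T_y x ≠ x` for almost every `x`, for each `y ≠ 0`; see
`isFreeAction_iff_ae_vadd_ne`. -/
def IsFreeAction (d : ℕ) [MeasurableSpace X] [AddAction (Fin d → ℤ) X] (μ : Measure X) : Prop :=
  ∀ y : Fin d → ℤ, y ≠ 0 → ∀ A : Set X, MeasurableSet A → 0 < μ A →
    ∃ B ⊆ A, MeasurableSet B ∧ 0 < μ B ∧ μ (B ∩ (fun x => y +ᵥ x) ⁻¹' B) = 0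

theorem isFreeAction_iff_ae_vadd_ne [MeasurableSpace X] [MeasurableSpace.CountablySeparated X]
    [AddAction (Fin d → ℤ) X] [MeasurableConstVAdd (Fin d → ℤ) X] (μ : Measure X) :
    IsFreeAction d μ ↔ ∀ y : Fin d → ℤ, y ≠ 0 → ∀ᵐ x ∂μ, y +ᵥ x ≠ x := by
  obtain ⟨s, hs, hm, hsep⟩ :=
    exists_countable_separating X (MeasurableSet : Set X → Prop) Set.univ
  have hT : ∀ y : Fin d → ℤ, Measurable (fun x : X => y +ᵥ x) := fun y => measurable_const_vadd y
  -- the points which `T_y` moves from `t` to its complement, or back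
  let D : (Fin d → ℤ) → Set X → Set X := fun y t =>
    (t ∩ (fun x => y +ᵥ x) ⁻¹' tᶜ) ∪ (tᶜ ∩ (fun x => y +ᵥ x) ⁻¹' t)
  have hU : ∀ y : Fin d → ℤ, {x : X | y +ᵥ x ≠ x} = ⋃ t ∈ s, D y t := by
    intro y
    ext x
    simp only [Set.mem_ofPred_eq, Set.mem_iUnion, exists_prop]
    constructor
    · intro hx
      by_contra hcon
      push Not at hcon
      refine hx (hsep _ (Set.mem_univ _) _ (Set.mem_univ _) fun t ht => ?_)
      have := hcon t ht
      simp only [D, Set.mem_union, Set.mem_inter_iff, Set.mem_preimage, Set.mem_compl_iff] at this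
      tauto
    · rintro ⟨t, -, ht⟩ hx
      simp only [D, Set.mem_union, Set.mem_inter_iff, Set.mem_preimage, Set.mem_compl_iff, hx] at ht
      tauto
  have hUm : ∀ y : Fin d → ℤ, MeasurableSet {x : X | y +ᵥ x ≠ x} := by
    intro y
    rw [hU]
    refine MeasurableSet.biUnion hs fun t ht => ?_
    exact ((hm t ht).inter (hT y (hm t ht).compl)).union ((hm t ht).compl.inter (hT y (hm t ht)))
  constructor
  · intro h y hy
    rw [ae_iff]
    by_contra hpos
    obtain ⟨B, hBA, -, hB, hB0⟩ := h y hy {x : X | ¬ y +ᵥ x ≠ x} (hUm y).compl (pos_iff_ne_zero.2 hpos)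
    have : B ∩ (fun x => y +ᵥ x) ⁻¹' B = B := by
      refine Set.inter_eq_left.2 fun x hx => ?_
      have : y +ᵥ x = x := not_not.1 (hBA hx)
      simpa [this] using hx
    rw [this] at hB0
    exact hB.ne' hB0
  · intro h y hy A hA hA0
    by_contra hcon
    push Not at hcon
    have key : ∀ B ⊆ A, MeasurableSet B → Disjoint B ((fun x => y +ᵥ x) ⁻¹' B) → μ B = 0 := by
      intro B hBA hB hdisj
      by_contra hne
      exact hcon B hBA hB (pos_iff_ne_zero.2 hne) (by rw [hdisj.inter_eq]; simp)
    have hnull : μ (A ∩ ⋃ t ∈ s, D y t) = 0 := by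
      rw [Set.inter_iUnion₂, measure_biUnion_null_iff hs]
      intro t ht
      rw [Set.inter_union_distrib_left, measure_union_null_iff]
      constructor
      · refine key _ Set.inter_subset_left
          (hA.inter ((hm t ht).inter (hT y (hm t ht).compl))) (Set.disjoint_left.2 ?_)
        rintro x ⟨-, -, hx⟩ ⟨-, hx', -⟩
        exact hx hx'
      · refine key _ Set.inter_subset_left
          (hA.inter ((hm t ht).compl.inter (hT y (hm t ht)))) (Set.disjoint_left.2 ?_)
        rintro x ⟨-, -, hx⟩ ⟨-, hx', -⟩
        exact hx' hx
    have hle : μ A ≤ μ (A ∩ ⋃ t ∈ s, D y t) + μ {x : X | y +ᵥ x ≠ x}ᶜ := by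
      rw [← hU y]
      refine (measure_mono fun x hx => ?_).trans (measure_union_le _ _)
      by_cases hx' : y +ᵥ x ≠ x
      · exact Or.inl ⟨hx, hx'⟩
      · exact Or.inr hx'
    have h0 : μ {x : X | y +ᵥ x ≠ x}ᶜ = 0 := ae_iff.1 (h y hy)
    rw [hnull, h0, add_zero] at hle
    exact hA0.ne' (le_antisymm hle zero_le)

/-- The weak `L^p` (quasi)norm `sup_{λ ≥ 0} λ μ({g > λ})^{1/p}` of a nonnegative function,
for `0 < p < ∞`. -/
noncomputable def weakLpNorm [MeasurableSpace X] (g : X → ℝ≥0∞) (p : ℝ≥0∞) (μ : Measure X) :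
    ℝ≥0∞ :=
  ⨆ t : ℝ≥0, (t : ℝ≥0∞) * μ {x | (t : ℝ≥0∞) < g x} ^ (1 / p.toReal)

/-- `S` maps `L^p(μ)` to `L^{p,∞}(μ)` with norm at most `C`. -/
def HasWeakTypeBound [MeasurableSpace X] [RCLike 𝕜] (S : (X → 𝕜) → X → ℝ≥0∞) (p : ℝ≥0∞)
    (μ : Measure X) (C : ℝ≥0) : Prop :=
  ∀ f : X → 𝕜, MemLp f p μ → weakLpNorm (S f) p μ ≤ (C : ℝ≥0∞) * eLpNorm f p μ

/-- `M_E f (x) = |E|⁻¹ ∑_{y ∈ E} f (T_{-y} x)`, the ergodic average of `f` over `E ⊂ ℤ^d`. -/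
noncomputable def ergodicAverage [RCLike 𝕜] [AddAction (Fin d → ℤ) X]
    (E : Finset (Fin d → ℤ)) (f : X → 𝕜) (x : X) : 𝕜 :=
  (E.card : 𝕜)⁻¹ * ∑ y ∈ E, f ((-y) +ᵥ x)

/-- `S f = (∑_m |M_m f - M_{m+1} f|²)^{1/2}`, with values in `[0, ∞]`. -/
noncomputable def ergodicSquareFunction [RCLike 𝕜] [AddAction (Fin d → ℤ) X]
    (E : ℕ → Finset (Fin d → ℤ)) (f : X → 𝕜) (x : X) : ℝ≥0∞ :=
  (∑' m, ‖ergodicAverage (E m) f x - ergodicAverage (E (m + 1)) f x‖ₑ ^ 2) ^ (1 / 2 : ℝ)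

/-- `A_E f (n) = |E|⁻¹ ∑_{y ∈ E} f (n - y)`, the convolution average of `f` on `ℤ^d`. -/
noncomputable def latticeAverage [RCLike 𝕜]
    (E : Finset (Fin d → ℤ)) (f : (Fin d → ℤ) → 𝕜) (n : Fin d → ℤ) : 𝕜 :=
  (E.card : 𝕜)⁻¹ * ∑ y ∈ E, f (n - y)

/-- `(∑_m |A_m f - A_{m+1} f|²)^{1/2}` on `ℤ^d`, with values in `[0, ∞]`. -/
noncomputable def latticeSquareFunction [RCLike 𝕜]
    (E : ℕ → Finset (Fin d → ℤ)) (f : (Fin d → ℤ) → 𝕜) (n : Fin d → ℤ) : ℝ≥0∞ :=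
  (∑' m, ‖latticeAverage (E m) f n - latticeAverage (E (m + 1)) f n‖ₑ ^ 2) ^ (1 / 2 : ℝ)

end Dynamics

/-! ### Finite truncations of the square function: locality and sublinearity. -/

section TruncatedSquareFunction

open Filter Topology

variable {d : ℕ} {𝕜 : Type*} [RCLike 𝕜] {X Y : Type*} [AddAction (Fin d → ℤ) X]
  [AddAction (Fin d → ℤ) Y]

/-! Everything passes through `LatticeWeakBound`, the weak type inequality on `ℤ^d` for truncations
and finitely supported data. It is equivalent to the weak type bound on `X` with the same constant.
From `ℤ^d` to `X` this is Calderón's transference (`LatticeWeakBound.hasWeakTypeBound`): apply the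
inequality to orbit pieces over large boxes and integrate; the boundary of the box disappears in the
limit. In the other direction (`HasWeakTypeBound.latticeWeakBound`), freeness provides a set of
positive measure with disjoint translates over a box. Data on `ℤ^d` are copied onto this tower, and
the measure of the base cancels.

The substantial implication is from a.e. finiteness to a weak type bound. Baire category gives
`exists_forall_measure_lt_ergodicSquareFunction_le`: large values of `S f` occupy little measure,
uniformly over the unit ball of `L^p`. A Stein-type argument, `card_le_of_forall_measure_le`,
upgrades this to `LatticeWeakBound`. Lift `g` to a tower filling a fixed proportion of `X`. If `S g`
is large on `P`, about `|V| / |P|` translates of the large set of the lift `F` cover half of the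
tower (`exists_list_half_covered`). Add these translates of `F` with random signs. By sublinearity,
wherever one of them has a large square function, so does the sum with probability at least `1/2`.
Since `p ≤ 2`, the mean of the `p`-th power of the norm of the sum is at most the sum of the `p`-th
powers. Comparison with the uniform estimate bounds `|P|`. -/

/-- The square function `ergodicSquareFunction`, with the sum restricted to the first `N` terms. -/
noncomputable def truncSquareFunction (E : ℕ → Finset (Fin d → ℤ)) (N : ℕ) (f : X → 𝕜) (x : X) :
    ℝ≥0∞ :=
  (∑ m ∈ Finset.range N,
    ‖ergodicAverage (E m) f x - ergodicAverage (E (m + 1)) f x‖ₑ ^ (2 : ℝ)) ^ (1 / 2 : ℝ)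

/-- The translations on which the truncated square function depends. -/
def translationRange (E : ℕ → Finset (Fin d → ℤ)) (N : ℕ) : Finset (Fin d → ℤ) :=
  (Finset.range (N + 1)).biUnion E

theorem subset_translationRange (E : ℕ → Finset (Fin d → ℤ)) {m N : ℕ} (h : m ≤ N) :
    E m ⊆ translationRange E N :=
  Finset.subset_biUnion_of_mem E (Finset.mem_range.2 (Nat.lt_succ_of_le h))

variable (E : ℕ → Finset (Fin d → ℤ)) (N : ℕ)

theorem ergodicSquareFunction_eq_iSup (f : X → 𝕜) (x : X) :
    ergodicSquareFunction E f x = ⨆ N, truncSquareFunction E N f x := by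
  have h2 : (0 : ℝ) < 1 / 2 := by norm_num
  rw [ergodicSquareFunction, ENNReal.tsum_eq_iSup_nat]
  have := (ENNReal.orderIsoRpow (1 / 2 : ℝ) h2).map_iSup fun N => ∑ m ∈ Finset.range N,
    ‖ergodicAverage (E m) f x - ergodicAverage (E (m + 1)) f x‖ₑ ^ 2
  simpa only [ENNReal.orderIsoRpow_apply, truncSquareFunction, ENNReal.rpow_ofNat] using this

theorem lt_ergodicSquareFunction_iff {t : ℝ≥0∞} (f : X → 𝕜) (x : X) :
    t < ergodicSquareFunction E f x ↔ ∃ N, t < truncSquareFunction E N f x := by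
  rw [ergodicSquareFunction_eq_iSup, lt_iSup_iff]

theorem truncSquareFunction_mono (f : X → 𝕜) (x : X) :
    Monotone fun N => truncSquareFunction E N f x := by
  intro M N h
  refine ENNReal.rpow_le_rpow ?_ (by norm_num)
  exact Finset.sum_le_sum_of_subset (Finset.range_subset_range.2 h)

theorem measure_lt_ergodicSquareFunction [MeasurableSpace X] (μ : Measure X) (t : ℝ≥0∞)
    (f : X → 𝕜) : μ {x | t < ergodicSquareFunction E f x} =
      ⨆ N, μ {x | t < truncSquareFunction E N f x} := by
  have : {x | t < ergodicSquareFunction E f x} = ⋃ N, {x | t < truncSquareFunction E N f x} := by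
    ext x
    simp [lt_ergodicSquareFunction_iff]
  rw [this]
  refine Monotone.measure_iUnion fun M N h x hx => ?_
  exact lt_of_lt_of_le hx (truncSquareFunction_mono E f x h)

-- Only finitely many values along the orbit matter. Two different spaces are allowed so that an
-- orbit in `X` can be compared with `ℤ^d`, and data can be cut off to finite sets.
variable {E N} in
theorem truncSquareFunction_congr {f : X → 𝕜} {g : Y → 𝕜} {x : X} {z : Y}
    (h : ∀ y ∈ translationRange E N, f (-y +ᵥ x) = g (-y +ᵥ z)) :
    truncSquareFunction E N f x = truncSquareFunction E N g z := by
  have key : ∀ m ≤ N, ergodicAverage (E m) f x = ergodicAverage (E m) g z := by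
    intro m hm
    unfold ergodicAverage
    rw [Finset.sum_congr rfl fun y hy => h y (subset_translationRange E hm hy)]
  unfold truncSquareFunction
  congr 1
  refine Finset.sum_congr rfl fun m hm => ?_
  rw [Finset.mem_range] at hm
  rw [key m hm.le, key (m + 1) hm]

theorem ergodicAverage_add (F : Finset (Fin d → ℤ)) (f g : X → 𝕜) (x : X) :
    ergodicAverage F (f + g) x = ergodicAverage F f x + ergodicAverage F g x := by
  simp [ergodicAverage, Finset.sum_add_distrib, mul_add]

theorem ergodicAverage_smul (F : Finset (Fin d → ℤ)) (c : 𝕜) (f : X → 𝕜) (x : X) :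
    ergodicAverage F (c • f) x = c * ergodicAverage F f x := by
  simp [ergodicAverage, ← Finset.mul_sum, mul_left_comm]

theorem truncSquareFunction_add_le (f g : X → 𝕜) (x : X) :
    truncSquareFunction E N (f + g) x ≤
      truncSquareFunction E N f x + truncSquareFunction E N g x := by
  refine le_trans ?_ (ENNReal.Lp_add_le _ _ _ (by norm_num : (1 : ℝ) ≤ 2))
  refine ENNReal.rpow_le_rpow ?_ (by norm_num)
  refine Finset.sum_le_sum fun m _ => ENNReal.rpow_le_rpow ?_ (by norm_num)
  rw [ergodicAverage_add, ergodicAverage_add, add_sub_add_comm]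
  exact enorm_add_le _ _

theorem truncSquareFunction_smul (c : 𝕜) (f : X → 𝕜) (x : X) :
    truncSquareFunction E N (c • f) x = ‖c‖ₑ * truncSquareFunction E N f x := by
  simp only [truncSquareFunction, ergodicAverage_smul, ← mul_sub, enorm_mul]
  simp only [ENNReal.mul_rpow_of_nonneg _ _ (by norm_num : (0 : ℝ) ≤ 2), ← Finset.mul_sum]
  rw [ENNReal.mul_rpow_of_nonneg _ _ (by norm_num), ← ENNReal.rpow_mul]
  norm_num

theorem truncSquareFunction_neg (f : X → 𝕜) (x : X) :
    truncSquareFunction E N (-f) x = truncSquareFunction E N f x := by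
  have := truncSquareFunction_smul E N (-1 : 𝕜) f x
  simpa using this

/-- Sublinearity applied to `2 f = (h + f) - (h - f)`. Whatever `h` is, one of the two signs makes
the square function at `x` at least that of `f`; this drives the random sign argument. -/
theorem two_mul_truncSquareFunction_le (f h : X → 𝕜) (x : X) :
    2 * truncSquareFunction E N f x ≤
      truncSquareFunction E N (h + f) x + truncSquareFunction E N (h - f) x := by
  have h1 := truncSquareFunction_add_le E N (h + f) (-(h - f)) x
  rw [truncSquareFunction_neg] at h1
  have h2 : h + f + -(h - f) = (2 : 𝕜) • f := by
    rw [two_smul]; abel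
  rw [h2, truncSquareFunction_smul] at h1
  have h3 : ‖(2 : 𝕜)‖ₑ = 2 := by
    rw [← ofReal_norm, RCLike.norm_ofNat]; simp
  rwa [h3] at h1

theorem ergodicSquareFunction_smul (c : 𝕜) (f : X → 𝕜) (x : X) :
    ergodicSquareFunction E (c • f) x = ‖c‖ₑ * ergodicSquareFunction E f x := by
  simp only [ergodicSquareFunction_eq_iSup, truncSquareFunction_smul, ENNReal.mul_iSup]

theorem ergodicSquareFunction_add_le (f g : X → 𝕜) (x : X) :
    ergodicSquareFunction E (f + g) x ≤
      ergodicSquareFunction E f x + ergodicSquareFunction E g x := by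
  simp only [ergodicSquareFunction_eq_iSup]
  refine iSup_le fun N => (truncSquareFunction_add_le E N f g x).trans ?_
  exact add_le_add (le_iSup (fun N => truncSquareFunction E N f x) N)
    (le_iSup (fun N => truncSquareFunction E N g x) N)

theorem truncSquareFunction_comp_vadd (f : X → 𝕜) (v : Fin d → ℤ) (x : X) :
    truncSquareFunction E N (fun x => f (v +ᵥ x)) x = truncSquareFunction E N f (v +ᵥ x) := by
  refine truncSquareFunction_congr fun y _ => ?_
  simp only [vadd_vadd, add_comm]

/-- Restricting to an orbit turns the action into the translation action on `ℤ^d`. -/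
theorem truncSquareFunction_orbit (f : X → 𝕜) (n : Fin d → ℤ) (x : X) :
    truncSquareFunction E N (fun n : Fin d → ℤ => f (n +ᵥ x)) n =
      truncSquareFunction E N f (n +ᵥ x) := by
  refine truncSquareFunction_congr fun y _ => ?_
  simp only [vadd_eq_add, vadd_vadd]

theorem latticeSquareFunction_eq (f : (Fin d → ℤ) → 𝕜) :
    latticeSquareFunction E f = ergodicSquareFunction E f := by
  funext n
  simp only [latticeSquareFunction, ergodicSquareFunction, latticeAverage, ergodicAverage,
    vadd_eq_add, neg_add_eq_sub]

theorem measurable_truncSquareFunction [MeasurableSpace X] [MeasurableConstVAdd (Fin d → ℤ) X]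
    {f : X → 𝕜} (hf : Measurable f) : Measurable (truncSquareFunction E N f) := by
  have h : ∀ F : Finset (Fin d → ℤ), Measurable (ergodicAverage F f) := fun F =>
    (Finset.measurable_fun_sum _ fun y _ => hf.comp (measurable_const_vadd (-y))).const_mul _
  unfold truncSquareFunction
  exact (Finset.measurable_fun_sum _ fun m _ => ((h _).sub (h _)).enorm.pow_const _).pow_const _

theorem tendsto_truncSquareFunction {ι : Type*} {l : Filter ι} {f : ι → X → 𝕜} {g : X → 𝕜} {x : X}
    (h : ∀ y : Fin d → ℤ, Tendsto (fun i => f i (-y +ᵥ x)) l (𝓝 (g (-y +ᵥ x)))) :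
    Tendsto (fun i => truncSquareFunction E N (f i) x) l (𝓝 (truncSquareFunction E N g x)) := by
  have hA : ∀ F : Finset (Fin d → ℤ),
      Tendsto (fun i => ergodicAverage F (f i) x) l (𝓝 (ergodicAverage F g x)) := fun F =>
    (tendsto_finsetSum _ fun y _ => h y).const_mul _
  unfold truncSquareFunction
  refine ((ENNReal.continuous_rpow_const (y := (1 / 2 : ℝ))).tendsto _).comp ?_
  refine tendsto_finsetSum _ fun m _ => ?_
  exact ((ENNReal.continuous_rpow_const (y := (2 : ℝ))).tendsto _).comp
    (((hA _).sub (hA _)).enorm)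

variable [MeasurableSpace X] [MeasurableConstVAdd (Fin d → ℤ) X] {μ : Measure X}
  [VAddInvariantMeasure (Fin d → ℤ) X μ]

/-- The group is countable and each translation preserves null sets. -/
theorem ae_forall_vadd {q : X → Prop} (h : ∀ᵐ x ∂μ, q x) :
    ∀ᵐ x ∂μ, ∀ y : Fin d → ℤ, q (y +ᵥ x) := by
  rw [ae_all_iff]
  intro y
  exact (measurePreserving_vadd y μ).quasiMeasurePreserving.ae h

theorem truncSquareFunction_ae_congr {f g : X → 𝕜} (h : f =ᵐ[μ] g) :
    ∀ᵐ x ∂μ, ∀ N, truncSquareFunction E N f x = truncSquareFunction E N g x := by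
  filter_upwards [ae_forall_vadd (d := d) h] with x hx N
  exact truncSquareFunction_congr fun y _ => hx (-y)

theorem ergodicSquareFunction_ae_congr {f g : X → 𝕜} (h : f =ᵐ[μ] g) :
    ergodicSquareFunction E f =ᵐ[μ] ergodicSquareFunction E g := by
  filter_upwards [truncSquareFunction_ae_congr E h] with x hx
  simp only [ergodicSquareFunction_eq_iSup, hx]

end TruncatedSquareFunction

/-! ### Weak type bounds in `p`-th powers and reduction to finite data on `ℤ^d`. -/

section WeakType

variable {d : ℕ} {𝕜 : Type*} [RCLike 𝕜] {X : Type*}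

theorem hasWeakTypeBound_iff [MeasurableSpace X] {S : (X → 𝕜) → X → ℝ≥0∞} {p : ℝ≥0∞} (hp : p ≠ 0)
    (hp' : p ≠ ∞) {μ : Measure X} {C : ℝ≥0} :
    HasWeakTypeBound S p μ C ↔ ∀ f : X → 𝕜, MemLp f p μ → ∀ t : ℝ≥0,
      (t : ℝ≥0∞) ^ p.toReal * μ {x | (t : ℝ≥0∞) < S f x} ≤
        (C : ℝ≥0∞) ^ p.toReal * ∫⁻ x, ‖f x‖ₑ ^ p.toReal ∂μ := by
  have hr : 0 < p.toReal := ENNReal.toReal_pos hp hp'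
  unfold HasWeakTypeBound weakLpNorm
  refine forall₂_congr fun f _ => ?_
  rw [iSup_le_iff]
  refine forall_congr' fun t => ?_
  rw [← ENNReal.rpow_le_rpow_iff hr, ENNReal.mul_rpow_of_nonneg _ _ hr.le,
    ENNReal.mul_rpow_of_nonneg _ _ hr.le, ← ENNReal.rpow_mul, one_div, inv_mul_cancel₀ hr.ne',
    ENNReal.rpow_one, eLpNorm_eq_lintegral_rpow_enorm_toReal hp hp', ← ENNReal.rpow_mul, one_div,
    inv_mul_cancel₀ hr.ne', ENNReal.rpow_one]

/-- The weak type `(r, r)` inequality, in `r`-th powers, for the truncations of the square function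
of `ℤ^d` and finitely supported functions. -/
def LatticeWeakBound (𝕜 : Type*) [RCLike 𝕜] (E : ℕ → Finset (Fin d → ℤ)) (r : ℝ) (C : ℝ≥0∞) :
    Prop :=
  ∀ (N : ℕ) (g : (Fin d → ℤ) → 𝕜) (t : ℝ≥0) (P W : Finset (Fin d → ℤ)), (∀ n ∉ W, g n = 0) →
    (∀ n ∈ P, (t : ℝ≥0∞) < truncSquareFunction E N g n) →
    (t : ℝ≥0∞) ^ r * (P.card : ℝ≥0∞) ≤ C * ∑ w ∈ W, ‖g w‖ₑ ^ r

theorem latticeWeakBound_iff (E : ℕ → Finset (Fin d → ℤ)) {p : ℝ≥0∞} (hp : p ≠ 0)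
    (hp' : p ≠ ∞) (C : ℝ≥0) : LatticeWeakBound 𝕜 E p.toReal ((C : ℝ≥0∞) ^ p.toReal) ↔
      HasWeakTypeBound (𝕜 := 𝕜) (latticeSquareFunction E) p Measure.count C := by
  classical
  have hr : 0 < p.toReal := ENNReal.toReal_pos hp hp'
  rw [hasWeakTypeBound_iff hp hp']
  constructor
  · intro h f _ t
    rw [lintegral_count]
    rw [latticeSquareFunction_eq, measure_lt_ergodicSquareFunction, ENNReal.mul_iSup]
    refine iSup_le fun N => ?_
    have hfin : ∀ P : Finset (Fin d → ℤ), (↑P ⊆ {n | (t : ℝ≥0∞) < truncSquareFunction E N f n}) →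
        (t : ℝ≥0∞) ^ p.toReal * (P.card : ℝ≥0∞) ≤
          (C : ℝ≥0∞) ^ p.toReal * ∑' n, ‖f n‖ₑ ^ p.toReal := by
      intro P hP
      -- `W` contains every site seen by the truncated square function from `P`, so cutting `f` off
      -- outside `W` does not change it there.
      let W := Finset.image₂ (fun n y : Fin d → ℤ => -y + n) P (translationRange E N)
      refine (h N (fun n => if n ∈ W then f n else 0) t P W (fun n hn => if_neg hn)
        fun n hn => ?_).trans ?_
      · refine lt_of_lt_of_eq (hP hn) (truncSquareFunction_congr fun y hy => ?_)
        rw [vadd_eq_add, if_pos (Finset.mem_image₂_of_mem hn hy)]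
      · gcongr
        rw [Finset.sum_congr rfl fun w hw => by rw [if_pos hw]]
        exact ENNReal.sum_le_tsum _
    rw [Measure.count_apply (Set.to_countable _).measurableSet]
    by_cases hs : {n | (t : ℝ≥0∞) < truncSquareFunction E N f n}.Finite
    · have := hfin hs.toFinset (by simp)
      rwa [hs.encard_eq_coe_toFinset_card]
    · rcases eq_or_ne t 0 with rfl | ht
      · simp [ENNReal.zero_rpow_of_pos hr]
      have hinf : {n | (t : ℝ≥0∞) < truncSquareFunction E N f n}.Infinite := hs
      -- Arbitrarily large finite subsets of the level set satisfy the bound, which forces the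
      -- right-hand side to be infinite.
      have htop : (C : ℝ≥0∞) ^ p.toReal * ∑' n, ‖f n‖ₑ ^ p.toReal = ∞ := by
        have ht' : (t : ℝ≥0∞) ^ p.toReal ≠ 0 := by
          simp [ENNReal.rpow_eq_zero_iff, ht]
        refine ENNReal.eq_top_of_forall_nnreal_le fun a => ?_
        obtain ⟨k, hk⟩ := ENNReal.exists_nat_mul_gt ht' (ENNReal.coe_ne_top (r := a))
        obtain ⟨P, hP, hPc⟩ := hinf.exists_subset_card_eq k
        have := hfin P hP
        rw [hPc, mul_comm] at this
        exact hk.le.trans this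
      rw [htop]
      exact le_top
  · intro h N g t P W hW hP
    have hlin : ∫⁻ n, ‖g n‖ₑ ^ p.toReal ∂Measure.count = ∑ w ∈ W, ‖g w‖ₑ ^ p.toReal := by
      rw [lintegral_count]
      exact tsum_eq_sum fun n hn => by simp [hW n hn, hr]
    have hg : MemLp g p Measure.count := by
      refine ⟨(measurable_of_countable g).aestronglyMeasurable, ?_⟩
      rw [eLpNorm_lt_top_iff_lintegral_rpow_enorm_lt_top hp hp', hlin]
      exact ENNReal.sum_lt_top.2 fun w _ => ENNReal.rpow_lt_top_of_nonneg hr.le enorm_ne_top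
    rw [← hlin]
    refine le_trans ?_ (h g hg t)
    gcongr
    rw [← Measure.count_apply_finset]
    refine measure_mono fun n hn => ?_
    rw [Set.mem_ofPred_eq, latticeSquareFunction_eq, lt_ergodicSquareFunction_iff]
    exact ⟨N, hP n hn⟩

end WeakType

/-! ### Boxes in `ℤ^d` and their Følner property. -/

section Box

open Filter Topology

variable {d : ℕ}

/-- The box `[-L, L]^d`. -/
noncomputable def latticeBox (d L : ℕ) : Finset (Fin d → ℤ) :=
  Fintype.piFinset fun _ => Finset.Icc (-(L : ℤ)) L

theorem mem_latticeBox {L : ℕ} {n : Fin d → ℤ} : n ∈ latticeBox d L ↔ ∀ i, |n i| ≤ L := by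
  simp [latticeBox, Fintype.mem_piFinset, abs_le]

theorem card_latticeBox (L : ℕ) : (latticeBox d L).card = (2 * L + 1) ^ d := by
  have : ((L : ℤ) + 1 + L).toNat = 2 * L + 1 := by omega
  simp [latticeBox, Fintype.card_piFinset, this]

theorem neg_mem_latticeBox {L : ℕ} {n : Fin d → ℤ} (h : n ∈ latticeBox d L) :
    -n ∈ latticeBox d L := by
  rw [mem_latticeBox] at h ⊢
  simpa using h

theorem add_mem_latticeBox {L M : ℕ} {m n : Fin d → ℤ} (hm : m ∈ latticeBox d L)
    (hn : n ∈ latticeBox d M) : m + n ∈ latticeBox d (L + M) := by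
  rw [mem_latticeBox] at *
  intro i
  push_cast
  exact (abs_add_le _ _).trans (add_le_add (hm i) (hn i))

theorem sub_mem_latticeBox {L M : ℕ} {m n : Fin d → ℤ} (hm : m ∈ latticeBox d L)
    (hn : n ∈ latticeBox d M) : m - n ∈ latticeBox d (L + M) := by
  rw [sub_eq_add_neg]
  exact add_mem_latticeBox hm (neg_mem_latticeBox hn)

theorem latticeBox_mono {L M : ℕ} (h : L ≤ M) : latticeBox d L ⊆ latticeBox d M := by
  intro n hn
  rw [mem_latticeBox] at *
  exact fun i => (hn i).trans (by exact_mod_cast h)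

theorem exists_subset_latticeBox (F : Finset (Fin d → ℤ)) : ∃ R, F ⊆ latticeBox d R := by
  refine ⟨∑ n ∈ F, ∑ i, (n i).natAbs, fun n hn => mem_latticeBox.2 fun i => ?_⟩
  rw [Int.abs_eq_natAbs]
  have h1 : (n i).natAbs ≤ ∑ i, (n i).natAbs :=
    Finset.single_le_sum (f := fun i => (n i).natAbs) (fun _ _ => Nat.zero_le _)
      (Finset.mem_univ i)
  have h2 := Finset.single_le_sum (f := fun n : Fin d → ℤ => ∑ i, (n i).natAbs)
    (fun _ _ => Nat.zero_le _) hn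
  exact_mod_cast h1.trans h2

theorem tendsto_card_latticeBox_div (d R : ℕ) :
    Tendsto (fun L => ((latticeBox d (L + R)).card : ℝ≥0∞) / (latticeBox d L).card) atTop
      (𝓝 1) := by
  have h1 : Tendsto (fun L : ℕ => 1 + (2 * R : ℝ) / (2 * L + 1)) atTop (𝓝 (1 + 0)) := by
    refine tendsto_const_nhds.add (tendsto_const_nhds.div_atTop ?_)
    exact tendsto_atTop_add_const_right _ _
      (tendsto_natCast_atTop_atTop.const_mul_atTop (by norm_num))
  have h2 := ENNReal.tendsto_ofReal (h1.pow d)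
  simp only [add_zero, one_pow, ENNReal.ofReal_one] at h2
  refine h2.congr fun L => ?_
  have hL : (0 : ℝ) < 2 * L + 1 := by positivity
  rw [card_latticeBox, card_latticeBox, ← ENNReal.ofReal_natCast, ← ENNReal.ofReal_natCast,
    ← ENNReal.ofReal_div_of_pos (by positivity)]
  push_cast
  rw [← div_pow]
  congr 2
  field_simp
  ring

end Box

/-! ### Calderón transference from `ℤ^d` to `X`. -/

section Transference

open Filter Topology

variable {d : ℕ} {𝕜 : Type*} [RCLike 𝕜] {X : Type*} [AddAction (Fin d → ℤ) X] [MeasurableSpace X]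
  [MeasurableConstVAdd (Fin d → ℤ) X] {μ : Measure X} [VAddInvariantMeasure (Fin d → ℤ) X μ]
  {E : ℕ → Finset (Fin d → ℤ)}

/-- For each `x`, the lattice inequality is applied to `n ↦ f (n +ᵥ x)` cut off to `Q'`, which is
exact at the points of `Q`. Integration in `x` and invariance make every summand equal. -/
theorem LatticeWeakBound.card_mul_measure_le {r : ℝ} {C : ℝ≥0∞} (h : LatticeWeakBound 𝕜 E r C)
    (N : ℕ) {f : X → 𝕜} (hf : Measurable f) (t : ℝ≥0) {Q Q' : Finset (Fin d → ℤ)}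
    (hQ : ∀ n ∈ Q, ∀ y ∈ translationRange E N, -y + n ∈ Q') :
    (Q.card : ℝ≥0∞) * ((t : ℝ≥0∞) ^ r * μ {x | (t : ℝ≥0∞) < truncSquareFunction E N f x}) ≤
      C * (Q'.card * ∫⁻ x, ‖f x‖ₑ ^ r ∂μ) := by
  classical
  set A : Set X := {x | (t : ℝ≥0∞) < truncSquareFunction E N f x} with hA
  have hAm : MeasurableSet A := measurableSet_lt measurable_const (measurable_truncSquareFunction E N hf)
  have hpt : ∀ x, (t : ℝ≥0∞) ^ r * ∑ n ∈ Q, A.indicator 1 (n +ᵥ x) ≤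
      C * ∑ n ∈ Q', ‖f (n +ᵥ x)‖ₑ ^ r := by
    intro x
    have h1 := h N (fun n => if n ∈ Q' then f (n +ᵥ x) else 0) t {n ∈ Q | n +ᵥ x ∈ A} Q'
      (fun n hn => if_neg hn) fun n hn => by
        rw [Finset.mem_filter] at hn
        refine lt_of_lt_of_eq hn.2 ?_
        rw [← truncSquareFunction_orbit]
        refine truncSquareFunction_congr fun y hy => ?_
        rw [vadd_eq_add, if_pos (hQ n hn.1 y hy)]
    rw [Finset.sum_congr rfl fun w hw => by rw [if_pos hw]] at h1
    refine le_trans (le_of_eq ?_) h1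
    rw [Finset.card_filter]
    simp [Set.indicator_apply]
  have hint := lintegral_mono (μ := μ) hpt
  have hm1 : Measurable (A.indicator (1 : X → ℝ≥0∞)) := measurable_one.indicator hAm
  have hm2 : Measurable fun x => ‖f x‖ₑ ^ r := hf.enorm.pow_const _
  have hv1 : ∀ n : Fin d → ℤ, Measurable fun x => A.indicator (1 : X → ℝ≥0∞) (n +ᵥ x) := fun n =>
    hm1.comp (measurable_const_vadd n)
  have hv2 : ∀ n : Fin d → ℤ, Measurable fun x => ‖f (n +ᵥ x)‖ₑ ^ r := fun n =>
    hm2.comp (measurable_const_vadd n)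
  rw [lintegral_const_mul _ (Finset.measurable_fun_sum _ fun n _ => hv1 n),
    lintegral_const_mul _ (Finset.measurable_fun_sum _ fun n _ => hv2 n),
    lintegral_finsetSum _ fun n _ => hv1 n,
    lintegral_finsetSum _ fun n _ => hv2 n] at hint
  have e1 : ∀ n : Fin d → ℤ, ∫⁻ x, A.indicator 1 (n +ᵥ x) ∂μ = μ A := fun n => by
    rw [(measurePreserving_vadd n μ).lintegral_comp hm1, lintegral_indicator_one hAm]
  have e2 : ∀ n : Fin d → ℤ, ∫⁻ x, ‖f (n +ᵥ x)‖ₑ ^ r ∂μ = ∫⁻ x, ‖f x‖ₑ ^ r ∂μ := fun n =>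
    (measurePreserving_vadd n μ).lintegral_comp hm2
  simp only [e1, e2, Finset.sum_const, nsmul_eq_mul] at hint
  rwa [mul_left_comm]

theorem LatticeWeakBound.hasWeakTypeBound {p : ℝ≥0∞} (hp : p ≠ 0) (hp' : p ≠ ∞) {C : ℝ≥0}
    (h : LatticeWeakBound 𝕜 E p.toReal ((C : ℝ≥0∞) ^ p.toReal)) :
    HasWeakTypeBound (𝕜 := 𝕜) (X := X) (ergodicSquareFunction E) p μ C := by
  rw [hasWeakTypeBound_iff hp hp']
  intro f' hf' t
  obtain ⟨f, hf, hff⟩ := hf'.1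
  have hfm := hf.measurable
  have e1 : μ {x | (t : ℝ≥0∞) < ergodicSquareFunction E f' x} =
      μ {x | (t : ℝ≥0∞) < ergodicSquareFunction E f x} := by
    refine measure_congr ?_
    filter_upwards [ergodicSquareFunction_ae_congr E hff] with x hx
    exact congrArg ((t : ℝ≥0∞) < ·) hx
  have e2 : ∫⁻ x, ‖f' x‖ₑ ^ p.toReal ∂μ = ∫⁻ x, ‖f x‖ₑ ^ p.toReal ∂μ := by
    refine lintegral_congr_ae ?_
    filter_upwards [hff] with x hx
    rw [hx]
  have hfin : ∫⁻ x, ‖f x‖ₑ ^ p.toReal ∂μ ≠ ∞ := by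
    rw [← e2]
    exact (lintegral_rpow_enorm_lt_top_of_eLpNorm_lt_top hp hp' hf'.2).ne
  rw [e1, e2, measure_lt_ergodicSquareFunction, ENNReal.mul_iSup]
  refine iSup_le fun N => ?_
  obtain ⟨R, hR⟩ := exists_subset_latticeBox (translationRange E N)
  -- The ratio of the boxes of radii `L + R` and `L` tends to `1`, so the constant is transferred
  -- without loss.
  have hlim := ENNReal.Tendsto.const_mul (ENNReal.Tendsto.mul_const (tendsto_card_latticeBox_div d R)
    (Or.inr hfin)) (a := (C : ℝ≥0∞) ^ p.toReal)
    (Or.inr (ENNReal.rpow_ne_top_of_nonneg ENNReal.toReal_nonneg ENNReal.coe_ne_top))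
  rw [one_mul] at hlim
  refine ge_of_tendsto' hlim fun L => ?_
  have := h.card_mul_measure_le (μ := μ) N hfm t (Q := latticeBox d L) (Q' := latticeBox d (L + R))
    fun n hn y hy => by
      rw [neg_add_eq_sub]
      exact sub_mem_latticeBox hn (hR hy)
  have h0 : ((latticeBox d L).card : ℝ≥0∞) ≠ 0 := by
    rw [card_latticeBox]; positivity
  rw [mul_comm, ← ENNReal.le_div_iff_mul_le (Or.inl h0) (Or.inl (ENNReal.natCast_ne_top _))] at this
  refine this.trans (le_of_eq ?_)
  simp only [div_eq_mul_inv]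
  ring

end Transference

/-! ### Separated sets and towers for a free action. -/

section Tower

variable {d : ℕ} {X : Type*} [AddAction (Fin d → ℤ) X]

/-- `B` is disjoint from its translates by the nonzero elements of `D`. -/
def SeparatedBy (D : Finset (Fin d → ℤ)) (B : Set X) : Prop :=
  ∀ k ∈ D, k ≠ 0 → ∀ x ∈ B, k +ᵥ x ∉ B

/-- The union of the translates of `B` by the elements of `P`. -/
def towerSet (B : Set X) (P : Finset (Fin d → ℤ)) : Set X :=
  {x | ∃ n ∈ P, -n +ᵥ x ∈ B}

theorem SeparatedBy.eq_of_mem {D : Finset (Fin d → ℤ)} {B : Set X} (h : SeparatedBy D B) {x : X}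
    {m n : Fin d → ℤ} (hmn : m - n ∈ D) (hm : -m +ᵥ x ∈ B) (hn : -n +ᵥ x ∈ B) : m = n := by
  by_contra hne
  refine h _ hmn (sub_ne_zero.2 hne) _ hm ?_
  rw [vadd_vadd]
  convert hn using 2
  abel

theorem towerSet_eq_biUnion (B : Set X) (P : Finset (Fin d → ℤ)) :
    towerSet B P = ⋃ n ∈ P, {x | -n +ᵥ x ∈ B} := by
  ext x; simp [towerSet]

variable [MeasurableSpace X] [MeasurableConstVAdd (Fin d → ℤ) X] {μ : Measure X}

theorem measurableSet_vadd_mem {B : Set X} (hB : MeasurableSet B) (k : Fin d → ℤ) :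
    MeasurableSet {x : X | k +ᵥ x ∈ B} :=
  measurable_const_vadd k hB

theorem measurableSet_towerSet {B : Set X} (hB : MeasurableSet B) (P : Finset (Fin d → ℤ)) :
    MeasurableSet (towerSet B P) := by
  rw [towerSet_eq_biUnion]
  exact P.measurableSet_biUnion fun n _ => measurableSet_vadd_mem hB _

/-- Freeness is applied to one element of `D` at a time, shrinking the set at each step. -/
theorem IsFreeAction.exists_separatedBy (h : IsFreeAction d μ) (D : Finset (Fin d → ℤ)) {A : Set X}
    (hA : MeasurableSet A) (hA0 : 0 < μ A) :
    ∃ B ⊆ A, MeasurableSet B ∧ 0 < μ B ∧ SeparatedBy D B := by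
  classical
  induction D using Finset.induction_on with
  | empty => exact ⟨A, subset_rfl, hA, hA0, by simp [SeparatedBy]⟩
  | insert k D _ ih =>
    obtain ⟨B, hBA, hB, hB0, hBs⟩ := ih
    rcases eq_or_ne k 0 with rfl | hk
    · refine ⟨B, hBA, hB, hB0, fun j hj hj0 => ?_⟩
      exact hBs j ((Finset.mem_insert.1 hj).resolve_left hj0) hj0
    obtain ⟨B', hB'B, hB', hB'0, hnull⟩ := h k hk B hB hB0
    -- Removing the null overlap makes the separation hold at every point and not just almost
    -- everywhere.
    refine ⟨B' \ (B' ∩ (fun x => k +ᵥ x) ⁻¹' B'), Set.sdiff_subset.trans (hB'B.trans hBA),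
      hB'.diff (hB'.inter (measurable_const_vadd k hB')), ?_, fun j hj hj0 x hx hjx => ?_⟩
    · rwa [measure_sdiff_null hnull]
    · rcases Finset.mem_insert.1 hj with rfl | hj
      · exact hx.2 ⟨hx.1, hjx.1⟩
      · exact hBs j hj hj0 x (hB'B hx.1) (hB'B hjx.1)

omit [MeasurableConstVAdd (Fin d → ℤ) X] in
theorem measure_towerSet_le [VAddInvariantMeasure (Fin d → ℤ) X μ] (B : Set X)
    (P : Finset (Fin d → ℤ)) : μ (towerSet B P) ≤ P.card * μ B := by
  rw [towerSet_eq_biUnion]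
  refine (measure_biUnion_finset_le _ _).trans ?_
  have : ∀ n ∈ P, μ {x | -n +ᵥ x ∈ B} = μ B := fun n _ => measure_preimage_vadd μ (-n) B
  rw [Finset.sum_congr rfl this, Finset.sum_const, nsmul_eq_mul]

theorem SeparatedBy.measure_towerSet [VAddInvariantMeasure (Fin d → ℤ) X μ] {B : Set X}
    {D P : Finset (Fin d → ℤ)} (h : SeparatedBy D B) (hB : MeasurableSet B)
    (hP : ∀ m ∈ P, ∀ n ∈ P, m - n ∈ D) : μ (towerSet B P) = P.card * μ B := by
  rw [towerSet_eq_biUnion, measure_biUnion_finset]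
  · have : ∀ n ∈ P, μ {x | -n +ᵥ x ∈ B} = μ B := fun n _ => measure_preimage_vadd μ (-n) B
    rw [Finset.sum_congr rfl this, Finset.sum_const, nsmul_eq_mul]
  · intro m hm n hn hne
    exact Set.disjoint_left.2 fun x hx hx' => hne (h.eq_of_mem (hP m hm n hn) hx hx')
  · exact fun n _ => measurableSet_vadd_mem hB _

/-- A maximal separated set meets its translates almost everywhere. -/
theorem IsFreeAction.exists_separatedBy_one_le [IsProbabilityMeasure μ]
    [VAddInvariantMeasure (Fin d → ℤ) X μ] (h : IsFreeAction d μ) {D : Finset (Fin d → ℤ)}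
    (hD0 : 0 ∈ D) (hD : ∀ k ∈ D, -k ∈ D) :
    ∃ B : Set X, MeasurableSet B ∧ SeparatedBy D B ∧ 1 ≤ D.card * μ B := by
  let R : Set X → Set X → Prop := fun B B' => ∀ k ∈ D, ∀ x ∈ B, k +ᵥ x ∉ B'
  let S : Set (Set (Set X)) :=
    {𝓑 | (∀ B ∈ 𝓑, MeasurableSet B ∧ 0 < μ B ∧ SeparatedBy D B) ∧ 𝓑.Pairwise R}
  -- Zorn's lemma is applied to families of sets of positive measure: such families are countable,
  -- which keeps the union measurable.
  obtain ⟨𝓑, hmax⟩ : ∃ 𝓑, Maximal (· ∈ S) 𝓑 := by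
    refine zorn_subset S fun c hc hchain => ⟨⋃₀ c, ⟨?_, ?_⟩, fun s hs => Set.subset_sUnion_of_mem hs⟩
    · rintro B ⟨𝓑, h𝓑, hB⟩
      exact (hc h𝓑).1 B hB
    · exact (Set.pairwise_sUnion hchain.directedOn).2 fun 𝓑 h𝓑 => (hc h𝓑).2
  obtain ⟨hgood, hpair⟩ := hmax.prop
  have hcount : 𝓑.Countable := by
    have := Measure.countable_meas_pos_of_disjoint_iUnion (μ := μ) (As := fun B : 𝓑 => (B : Set X))
      (fun B => (hgood B B.2).1) fun B B' hne => Set.disjoint_left.2 fun x hx hx' =>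
        hpair B.2 B'.2 (fun h => hne (Subtype.ext h)) 0 hD0 x hx (by simpa using hx')
    have huniv : {B : 𝓑 | 0 < μ (B : Set X)} = Set.univ :=
      Set.eq_univ_of_forall fun B => (hgood B B.2).2.1
    rw [huniv, Set.countable_univ_iff] at this
    exact Set.countable_coe_iff.1 this
  have hBm : MeasurableSet (⋃₀ 𝓑) := MeasurableSet.sUnion hcount fun B hB => (hgood B hB).1
  refine ⟨⋃₀ 𝓑, hBm, ?_, ?_⟩
  · rintro k hk hk0 x ⟨B, hB, hx⟩ ⟨B', hB', hx'⟩
    rcases eq_or_ne B B' with rfl | hne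
    · exact (hgood B hB).2.2 k hk hk0 x hx hx'
    · exact hpair hB hB' hne k hk x hx hx'
  · refine le_trans ?_ (measure_towerSet_le _ _)
    by_contra hlt
    have hT := measurableSet_towerSet hBm D
    have hpos : 0 < μ (towerSet (⋃₀ 𝓑) D)ᶜ := by
      rw [prob_compl_eq_one_sub hT]
      exact tsub_pos_of_lt (not_le.1 hlt)
    -- If the translates missed a set of positive measure, a separated piece of it could be added to
    -- the maximal family.
    obtain ⟨B, hBsub, hB, hB0, hBs⟩ := h.exists_separatedBy D hT.compl hpos
    have hout : ∀ k ∈ D, ∀ x ∈ B, k +ᵥ x ∉ ⋃₀ 𝓑 := fun k hk x hx hx' =>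
      hBsub hx ⟨-k, hD k hk, by simpa using hx'⟩
    have hmem : insert B 𝓑 ∈ S := by
      refine ⟨?_, ?_⟩
      · rintro B' (rfl | hB')
        · exact ⟨hB, hB0, hBs⟩
        · exact hgood B' hB'
      · refine (Set.pairwise_insert).2 ⟨hpair, fun B' hB' _ => ⟨fun k hk x hx hx' =>
          hout k hk x hx ⟨B', hB', hx'⟩, fun k hk x hx hx' => ?_⟩⟩
        refine hout (-k) (hD k hk) _ hx' ⟨B', hB', ?_⟩
        rwa [neg_vadd_vadd]
    obtain ⟨x, hx⟩ := nonempty_of_measure_ne_zero hB0.ne'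
    refine hout 0 hD0 x hx ⟨B, hmax.le_of_ge hmem (Set.subset_insert _ _) (Set.mem_insert _ _), ?_⟩
    simpa using hx

end Tower

/-! ### Copying lattice functions onto a tower. -/

section Lift

variable {d : ℕ} {𝕜 : Type*} [RCLike 𝕜] {X : Type*} [AddAction (Fin d → ℤ) X]

open Classical in
/-- The function on `X` which takes the value `g w` on the translate of `B` by `w ∈ W`. -/
noncomputable def towerLift (B : Set X) (W : Finset (Fin d → ℤ)) (g : (Fin d → ℤ) → 𝕜) (x : X) : 𝕜 :=
  ∑ w ∈ W, if -w +ᵥ x ∈ B then g w else 0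

variable {B : Set X} {D W : Finset (Fin d → ℤ)} {g : (Fin d → ℤ) → 𝕜}

theorem SeparatedBy.towerLift_apply (h : SeparatedBy D B) (hg : ∀ n ∉ W, g n = 0)
    {n : Fin d → ℤ} (hn : ∀ w ∈ W, n - w ∈ D) {b : X} (hb : b ∈ B) :
    towerLift B W g (n +ᵥ b) = g n := by
  classical
  have key : ∀ w ∈ W, (-w +ᵥ (n +ᵥ b) ∈ B) ↔ w = n := by
    intro w hw
    constructor
    · intro hwb
      exact (h.eq_of_mem (hn w hw) (by simpa using hb) hwb).symm
    · rintro rfl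
      simpa using hb
  unfold towerLift
  rw [Finset.sum_congr rfl fun w hw => if_congr (key w hw) rfl rfl, Finset.sum_ite_eq']
  split_ifs with hnW
  · rfl
  · exact (hg n hnW).symm

theorem SeparatedBy.truncSquareFunction_towerLift (E : ℕ → Finset (Fin d → ℤ)) (N : ℕ)
    (h : SeparatedBy D B) (hg : ∀ n ∉ W, g n = 0) {n : Fin d → ℤ}
    (hn : ∀ y ∈ translationRange E N, ∀ w ∈ W, -y + n - w ∈ D) {b : X} (hb : b ∈ B) :
    truncSquareFunction E N (towerLift B W g) (n +ᵥ b) = truncSquareFunction E N g n := by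
  refine truncSquareFunction_congr fun y hy => ?_
  rw [vadd_vadd, h.towerLift_apply hg (hn y hy) hb, vadd_eq_add]

/-- By separation at most one summand of the lift is nonzero at `x`, so the power passes inside the
sum. -/
theorem SeparatedBy.enorm_towerLift_rpow_le (h : SeparatedBy D B)
    (hW : ∀ w ∈ W, ∀ w' ∈ W, w - w' ∈ D) {r : ℝ} (hr : 0 < r) (x : X) :
    ‖towerLift B W g x‖ₑ ^ r ≤
      ∑ w ∈ W, ‖g w‖ₑ ^ r * {x : X | -w +ᵥ x ∈ B}.indicator 1 x := by
  classical
  by_cases hx : ∃ w ∈ W, -w +ᵥ x ∈ B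
  · obtain ⟨w, hw, hwx⟩ := hx
    have : towerLift B W g x = g w := by
      unfold towerLift
      rw [Finset.sum_eq_single_of_mem w hw fun w' hw' hne => if_neg fun hw'x =>
        hne (h.eq_of_mem (hW w' hw' w hw) hw'x hwx), if_pos hwx]
    rw [this]
    refine le_trans (le_of_eq ?_) (Finset.single_le_sum (fun _ _ => zero_le) hw)
    rw [Set.indicator_of_mem (by exact hwx)]
    simp
  · push Not at hx
    have : towerLift B W g x = 0 := Finset.sum_eq_zero fun w hw => if_neg (hx w hw)
    simp [this, ENNReal.zero_rpow_of_pos hr]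

variable [MeasurableSpace X] [MeasurableConstVAdd (Fin d → ℤ) X] {μ : Measure X}
  {E : ℕ → Finset (Fin d → ℤ)}

theorem measurable_towerLift (hB : MeasurableSet B) : Measurable (towerLift B W g) := by
  classical
  exact Finset.measurable_fun_sum _ fun w _ =>
    Measurable.ite (measurableSet_vadd_mem hB _) measurable_const measurable_const

theorem SeparatedBy.lintegral_towerLift_le [VAddInvariantMeasure (Fin d → ℤ) X μ]
    (h : SeparatedBy D B) (hB : MeasurableSet B)
    (hW : ∀ w ∈ W, ∀ w' ∈ W, w - w' ∈ D) {r : ℝ} (hr : 0 < r) :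
    ∫⁻ x, ‖towerLift B W g x‖ₑ ^ r ∂μ ≤ μ B * ∑ w ∈ W, ‖g w‖ₑ ^ r := by
  refine (lintegral_mono (h.enorm_towerLift_rpow_le hW hr)).trans (le_of_eq ?_)
  have hm : ∀ w : Fin d → ℤ, MeasurableSet {x : X | -w +ᵥ x ∈ B} := fun w =>
    measurableSet_vadd_mem hB _
  rw [lintegral_finsetSum _ fun w _ => (measurable_one.indicator (hm w)).const_mul _,
    Finset.mul_sum]
  refine Finset.sum_congr rfl fun w _ => ?_
  rw [lintegral_const_mul _ (measurable_one.indicator (hm w)), lintegral_indicator_one (hm w),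
    mul_comm]
  congr 1
  exact measure_preimage_vadd μ (-w) B

theorem memLp_towerLift [IsFiniteMeasure μ] (hB : MeasurableSet B) (p : ℝ≥0∞) :
    MemLp (towerLift B W g) p μ := by
  refine MemLp.of_bound (measurable_towerLift hB).aestronglyMeasurable (∑ w ∈ W, ‖g w‖)
    (Filter.Eventually.of_forall fun x => ?_)
  refine (norm_sum_le _ _).trans (Finset.sum_le_sum fun w _ => ?_)
  split_ifs <;> simp

theorem HasWeakTypeBound.latticeWeakBound [IsProbabilityMeasure μ]
    [VAddInvariantMeasure (Fin d → ℤ) X μ] (hfree : IsFreeAction d μ) {p : ℝ≥0∞} (hp : p ≠ 0)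
    (hp' : p ≠ ∞) {C : ℝ≥0}
    (h : HasWeakTypeBound (𝕜 := 𝕜) (X := X) (ergodicSquareFunction E) p μ C) :
    LatticeWeakBound 𝕜 E p.toReal ((C : ℝ≥0∞) ^ p.toReal) := by
  classical
  rw [hasWeakTypeBound_iff hp hp'] at h
  intro N g t P W hg hP
  obtain ⟨R, hR⟩ := exists_subset_latticeBox (translationRange E N ∪ (P ∪ W))
  have hH : ∀ y ∈ translationRange E N, y ∈ latticeBox d R := fun y hy => hR (by simp [hy])
  have hPR : ∀ n ∈ P, n ∈ latticeBox d R := fun y hy => hR (by simp [hy])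
  have hWR : ∀ w ∈ W, w ∈ latticeBox d R := fun y hy => hR (by simp [hy])
  have hle : latticeBox d (R + R) ⊆ latticeBox d (R + R + R) := latticeBox_mono (by omega)
  -- Radius `3R` accommodates the differences `-y + n - w` of three elements of the box of radius
  -- `R`. Only positivity of `μ B` is needed, since it cancels at the end.
  obtain ⟨B, -, hB, hB0, hBs⟩ := hfree.exists_separatedBy (latticeBox d (R + R + R))
    (MeasurableSet.univ (α := X)) (by simp)
  have h1 := h (towerLift B W g) (memLp_towerLift hB p) t
  have h2 := hBs.lintegral_towerLift_le (μ := μ) (g := g) (W := W) hB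
    (fun w hw w' hw' => hle (sub_mem_latticeBox (hWR w hw) (hWR w' hw')))
    (ENNReal.toReal_pos hp hp')
  have h3 : P.card * μ B ≤ μ {x | (t : ℝ≥0∞) < ergodicSquareFunction E (towerLift B W g) x} := by
    rw [← hBs.measure_towerSet hB fun m hm n hn => hle (sub_mem_latticeBox (hPR m hm) (hPR n hn))]
    refine measure_mono ?_
    rintro x ⟨n, hn, hx⟩
    refine (lt_ergodicSquareFunction_iff E _ x).2 ⟨N, ?_⟩
    have := hBs.truncSquareFunction_towerLift E N hg (n := n) (fun y hy w hw =>
      sub_mem_latticeBox (add_mem_latticeBox (neg_mem_latticeBox (hH y hy)) (hPR n hn)) (hWR w hw)) hx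
    rw [vadd_neg_vadd] at this
    rw [this]
    exact hP n hn
  have h4 : ((t : ℝ≥0∞) ^ p.toReal * P.card) * μ B ≤
      ((C : ℝ≥0∞) ^ p.toReal * ∑ w ∈ W, ‖g w‖ₑ ^ p.toReal) * μ B := by
    calc _ = (t : ℝ≥0∞) ^ p.toReal * (P.card * μ B) := by ring
      _ ≤ _ := by gcongr
      _ ≤ _ := h1
      _ ≤ (C : ℝ≥0∞) ^ p.toReal * (μ B * ∑ w ∈ W, ‖g w‖ₑ ^ p.toReal) := by gcongr
      _ = _ := by ring
  exact (ENNReal.mul_le_mul_iff_left hB0.ne' (measure_ne_top _ _)).1 h4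

end Lift

/-! ### Banach's principle by Baire category. -/

section BanachPrinciple

open Filter Topology

variable {d : ℕ} {𝕜 : Type*} [RCLike 𝕜] {X : Type*} [AddAction (Fin d → ℤ) X] [MeasurableSpace X]
  [MeasurableConstVAdd (Fin d → ℤ) X] {μ : Measure X} [VAddInvariantMeasure (Fin d → ℤ) X μ]
  (E : ℕ → Finset (Fin d → ℤ))

/-- Along an a.e. convergent subsequence each truncation converges. As the inequality `t < ·` is
open, the level set of the limit lies, up to a null set, in the lower limit of the level sets. -/
theorem isClosed_measure_lt_ergodicSquareFunction_le (p : ℝ≥0∞) [Fact (1 ≤ p)] (t c : ℝ≥0∞) :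
    IsClosed {f : Lp 𝕜 p μ | μ {x | t < ergodicSquareFunction E f x} ≤ c} := by
  refine IsSeqClosed.isClosed fun u f hu huf => ?_
  obtain ⟨ns, -, hns⟩ := (tendstoInMeasure_of_tendsto_Lp huf).exists_seq_tendsto_ae
  rw [Set.mem_ofPred_eq, measure_lt_ergodicSquareFunction]
  refine iSup_le fun N => ?_
  have hsub : {x | t < truncSquareFunction E N f x} ≤ᵐ[μ]
      ⋃ j, ⋂ i, {x | t < truncSquareFunction E N (u (ns (j + i))) x} := by
    filter_upwards [ae_forall_vadd (d := d) hns] with x hx hlt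
    have := (tendsto_truncSquareFunction E N fun y => hx (-y)).eventually_const_lt hlt
    obtain ⟨j, hj⟩ := eventually_atTop.1 this
    exact Set.mem_iUnion.2 ⟨j, Set.mem_iInter.2 fun i => hj _ (Nat.le_add_right j i)⟩
  refine (measure_mono_ae hsub).trans ?_
  rw [Monotone.measure_iUnion]
  · refine iSup_le fun j => le_trans (measure_mono fun x hx => ?_) (hu (ns j))
    exact (lt_ergodicSquareFunction_iff E _ x).2 ⟨N, Set.mem_iInter.1 hx 0⟩
  · intro j k hjk x hx
    refine Set.mem_iInter.2 fun i => ?_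
    have := Set.mem_iInter.1 hx (k - j + i)
    rwa [← add_assoc, Nat.add_sub_cancel' hjk] at this

theorem measurable_ergodicSquareFunction {f : X → 𝕜} (hf : Measurable f) :
    Measurable (ergodicSquareFunction E f) := by
  have : ergodicSquareFunction E f = fun x => ⨆ N, truncSquareFunction E N f x :=
    funext (ergodicSquareFunction_eq_iSup E f)
  rw [this]
  exact Measurable.iSup fun N => measurable_truncSquareFunction E N hf

omit [VAddInvariantMeasure (Fin d → ℤ) X μ] in
theorem exists_measure_lt_ergodicSquareFunction_le [IsFiniteMeasure μ] {f : X → 𝕜}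
    (hf : Measurable f) (h : ∀ᵐ x ∂μ, ergodicSquareFunction E f x < ∞) {c : ℝ≥0∞} (hc : c ≠ 0) :
    ∃ n : ℕ, μ {x | (n : ℝ≥0∞) < ergodicSquareFunction E f x} ≤ c := by
  have hlim := tendsto_measure_iInter_atTop (μ := μ)
    (s := fun n : ℕ => {x | (n : ℝ≥0∞) < ergodicSquareFunction E f x})
    (fun n => (measurableSet_lt measurable_const
      (measurable_ergodicSquareFunction E hf)).nullMeasurableSet)
    (fun m n hmn x (hx : (n : ℝ≥0∞) < _) =>
      lt_of_le_of_lt (Nat.cast_le.2 hmn : (m : ℝ≥0∞) ≤ n) hx) ⟨0, measure_ne_top _ _⟩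
  have h0 : μ (⋂ n : ℕ, {x | (n : ℝ≥0∞) < ergodicSquareFunction E f x}) = 0 := by
    refine measure_mono_null (fun x hx => ?_) (ae_iff.1 h)
    rw [Set.mem_ofPred_eq, not_lt, top_le_iff]
    refine ENNReal.eq_top_of_forall_nnreal_le fun a => ?_
    obtain ⟨n, hn⟩ := exists_nat_ge a
    exact le_trans (by exact_mod_cast hn) (le_of_lt (Set.mem_iInter.1 hx n))
  rw [h0] at hlim
  obtain ⟨n, hn⟩ := (hlim.eventually_lt_const (pos_iff_ne_zero.2 hc)).exists
  exact ⟨n, hn.le⟩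

/-- Banach's principle: almost everywhere finiteness implies continuity in measure at `0`. -/
theorem exists_forall_measure_lt_ergodicSquareFunction_le [IsFiniteMeasure μ] {p : ℝ≥0∞}
    (hp : 1 ≤ p)
    (h : ∀ f : X → 𝕜, MemLp f p μ → ∀ᵐ x ∂μ, ergodicSquareFunction E f x < ∞)
    {c : ℝ≥0∞} (hc : c ≠ 0) :
    ∃ K : ℝ≥0, ∀ f : X → 𝕜, MemLp f p μ → eLpNorm f p μ ≤ 1 →
      μ {x | (K : ℝ≥0∞) < ergodicSquareFunction E f x} ≤ c := by
  have : Fact (1 ≤ p) := ⟨hp⟩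
  obtain ⟨n, f₀, hf₀⟩ := nonempty_interior_of_iUnion_of_closed
    (f := fun n : ℕ => {f : Lp 𝕜 p μ | μ {x | (n : ℝ≥0∞) < ergodicSquareFunction E f x} ≤ c / 2})
    (fun n => isClosed_measure_lt_ergodicSquareFunction_le E p n (c / 2))
    (Set.eq_univ_of_forall fun f => Set.mem_iUnion.2 <|
      exists_measure_lt_ergodicSquareFunction_le E (Lp.stronglyMeasurable f).measurable
        (h f (Lp.memLp f)) (ENNReal.div_ne_zero.2 ⟨hc, by simp⟩))
  obtain ⟨δ, hδ, hball⟩ := Metric.mem_nhds_iff.1 (mem_interior_iff_mem_nhds.1 hf₀)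
  have hδ2 : 0 < δ / 2 := by positivity
  set a : ℝ≥0 := ⟨δ / 2, hδ2.le⟩ with ha
  have ha0 : a ≠ 0 := fun h => hδ2.ne' (congrArg NNReal.toReal h)
  -- With `a = δ / 2`, both `f₀` and `g = f₀ + a f` lie in the ball found by Baire. Outside two sets
  -- of measure at most `c / 2`, one gets `a S f ≤ S g + S f₀ ≤ 2n`.
  refine ⟨a⁻¹ * (2 * n), fun f hf hf1 => ?_⟩
  set g : Lp 𝕜 p μ := f₀ + ((δ / 2 : ℝ) : 𝕜) • hf.toLp f with hg
  have hgmem : μ {x | (n : ℝ≥0∞) < ergodicSquareFunction E g x} ≤ c / 2 := by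
    refine hball (mem_ball_iff_norm.2 ?_)
    rw [hg, add_sub_cancel_left, norm_smul, Lp.norm_toLp, RCLike.norm_ofReal, abs_of_pos hδ2]
    have : (eLpNorm f p μ).toReal ≤ 1 := ENNReal.toReal_le_of_le_ofReal zero_le_one (by simpa using hf1)
    nlinarith
  have hf₀mem : μ {x | (n : ℝ≥0∞) < ergodicSquareFunction E f₀ x} ≤ c / 2 :=
    hball (Metric.mem_ball_self hδ)
  have hae : ((δ / 2 : ℝ) : 𝕜) • f =ᵐ[μ] g + (-1 : 𝕜) • f₀ := by
    filter_upwards [Lp.coeFn_add f₀ (((δ / 2 : ℝ) : 𝕜) • hf.toLp f),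
      Lp.coeFn_smul ((δ / 2 : ℝ) : 𝕜) (hf.toLp f), hf.coeFn_toLp] with x h1 h2 h3
    simp only [Pi.add_apply, Pi.smul_apply, hg, h1, h2, h3, smul_eq_mul]
    ring
  have hsub : {x | ((a⁻¹ * (2 * n) : ℝ≥0) : ℝ≥0∞) < ergodicSquareFunction E f x} ≤ᵐ[μ]
      ({x | (n : ℝ≥0∞) < ergodicSquareFunction E g x} ∪
        {x | (n : ℝ≥0∞) < ergodicSquareFunction E f₀ x} : Set X) := by
    filter_upwards [ergodicSquareFunction_ae_congr E hae] with x hx hlt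
    by_contra hcon
    replace hcon : ¬((n : ℝ≥0∞) < ergodicSquareFunction E g x ∨
      (n : ℝ≥0∞) < ergodicSquareFunction E f₀ x) := hcon
    simp only [not_or, not_lt] at hcon
    have h1 := ergodicSquareFunction_add_le E g ((-1 : 𝕜) • f₀) x
    rw [← hx, ergodicSquareFunction_smul, ergodicSquareFunction_smul] at h1
    have h2 : ‖((δ / 2 : ℝ) : 𝕜)‖ₑ = a := by
      rw [← ofReal_norm, RCLike.norm_ofReal, abs_of_pos hδ2, ENNReal.ofReal, ha]
      congr 1
      exact Real.toNNReal_of_nonneg hδ2.le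
    have h3 : ‖(-1 : 𝕜)‖ₑ = 1 := by simp
    rw [h2, h3, one_mul] at h1
    have h4 : (a : ℝ≥0∞) * ((a⁻¹ * (2 * n) : ℝ≥0) : ℝ≥0∞) < a * ergodicSquareFunction E f x :=
      (ENNReal.mul_lt_mul_iff_right (by simpa using ha0) ENNReal.coe_ne_top).2 hlt
    have h5 : (a : ℝ≥0∞) * ((a⁻¹ * (2 * n) : ℝ≥0) : ℝ≥0∞) = n + n := by
      rw [← ENNReal.coe_mul, mul_inv_cancel_left₀ ha0, two_mul]
      push_cast
      rfl
    rw [h5] at h4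
    exact absurd (h4.trans_le (h1.trans (add_le_add hcon.1 hcon.2))) (lt_irrefl _)
  calc _ ≤ _ := measure_mono_ae hsub
    _ ≤ _ := measure_union_le _ _
    _ ≤ c / 2 + c / 2 := add_le_add hgmem hf₀mem
    _ = c := ENNReal.add_halves c

end BanachPrinciple

/-! ### Averages over signs and the type inequality. -/

section SignAverage

variable {V : Type*} [AddCommGroup V]

/-- The average of `Φ (h + ∑ ± f)` over all choices of signs, with `f` running through the list. -/
noncomputable def signAverage (Φ : V → ℝ≥0∞) : List V → V → ℝ≥0∞
  | [], h => Φ h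
  | f :: l, h => (signAverage Φ l (h + f) + signAverage Φ l (h - f)) / 2

theorem signAverage_add_le {Φ Ψ Θ : V → ℝ≥0∞} (H : ∀ h, Φ h + Ψ h ≤ Θ h) (l : List V) (h : V) :
    signAverage Φ l h + signAverage Ψ l h ≤ signAverage Θ l h := by
  induction l generalizing h with
  | nil => exact H h
  | cons f l ih =>
    simp only [signAverage]
    rw [← ENNReal.add_div]
    refine ENNReal.div_le_div_right ?_ 2
    rw [add_add_add_comm]
    exact add_le_add (ih _) (ih _)

theorem le_signAverage_add_signAverage {Φ : V → ℝ≥0∞} {c : ℝ≥0∞} {f : V}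
    (H : ∀ h, c ≤ Φ (h + f) + Φ (h - f)) (l : List V) (h : V) :
    c ≤ signAverage Φ l (h + f) + signAverage Φ l (h - f) := by
  induction l generalizing h with
  | nil => exact H h
  | cons k l ih =>
    simp only [signAverage]
    rw [← ENNReal.add_div, ENNReal.le_div_iff_mul_le (by simp) (by simp), mul_two]
    refine (add_le_add (ih (h + k)) (ih (h - k))).trans (le_of_eq ?_)
    rw [add_right_comm h k f, add_sub_right_comm h k f, sub_add_eq_add_sub h k f,
      sub_right_comm h k f]
    abel

/-- Each sign costs at most one term `Φ f`, by the two-point inequality `hΦ`; induction adds these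
costs. -/
theorem signAverage_le_of_type {Φ Ψ : V → ℝ≥0∞} {c : ℝ≥0∞}
    (hΦ : ∀ h f, Φ (h + f) + Φ (h - f) ≤ 2 * (Φ h + Φ f)) (hΨ : ∀ h, Ψ h ≤ c + Φ h)
    (l : List V) (h : V) : signAverage Ψ l h ≤ c + Φ h + (l.map Φ).sum := by
  induction l generalizing h with
  | nil => simpa [signAverage] using hΨ h
  | cons f l ih =>
    simp only [signAverage, List.map_cons, List.sum_cons]
    rw [ENNReal.div_le_iff (by simp) (by simp)]
    calc _ ≤ (c + Φ (h + f) + (l.map Φ).sum) + (c + Φ (h - f) + (l.map Φ).sum) :=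
          add_le_add (ih _) (ih _)
      _ = 2 * (c + (l.map Φ).sum) + (Φ (h + f) + Φ (h - f)) := by ring
      _ ≤ 2 * (c + (l.map Φ).sum) + 2 * (Φ h + Φ f) := by gcongr; exact hΦ h f
      _ = _ := by ring

end SignAverage

/-- The case `r = 2` is the parallelogram law. For smaller `r`, concavity and then subadditivity of
`u ↦ u ^ (r / 2)` reduce to it. -/
theorem enorm_add_rpow_add_enorm_sub_rpow_le {𝕜 : Type*} [RCLike 𝕜] {r : ℝ} (hr : 0 < r)
    (hr2 : r ≤ 2) (a b : 𝕜) :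
    ‖a + b‖ₑ ^ r + ‖a - b‖ₑ ^ r ≤ 2 * (‖a‖ₑ ^ r + ‖b‖ₑ ^ r) := by
  have hpar : ‖a + b‖ₑ ^ (2 : ℝ) + ‖a - b‖ₑ ^ (2 : ℝ) = 2 * (‖a‖ₑ ^ (2 : ℝ) + ‖b‖ₑ ^ (2 : ℝ)) := by
    have h := parallelogram_law_with_norm ℝ a b
    have h' : ‖a + b‖₊ ^ 2 + ‖a - b‖₊ ^ 2 = 2 * (‖a‖₊ ^ 2 + ‖b‖₊ ^ 2) := by
      ext
      push_cast
      simpa only [sq] using h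
    simp only [ENNReal.rpow_two, enorm_eq_nnnorm]
    exact_mod_cast h'
  set s := r / 2 with hs
  have hs0 : 0 < s := by positivity
  have hs1 : s ≤ 1 := by rw [hs]; linarith
  have hpow : ∀ z : 𝕜, ‖z‖ₑ ^ r = (‖z‖ₑ ^ (2 : ℝ)) ^ s := fun z => by
    rw [← ENNReal.rpow_mul]; congr 1; rw [hs]; ring
  have hmean : ∀ u v : ℝ≥0∞, 2⁻¹ * (u ^ s + v ^ s) ≤ (2⁻¹ * (u + v)) ^ s := fun u v => by
    have := ENNReal.rpow_arith_mean_le_arith_mean2_rpow 2⁻¹ 2⁻¹ (u ^ s) (v ^ s)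
      ENNReal.inv_two_add_inv_two ((one_le_inv₀ hs0).2 hs1)
    rwa [ENNReal.rpow_rpow_inv hs0.ne', ENNReal.rpow_rpow_inv hs0.ne', ← mul_add, ← mul_add,
      ENNReal.rpow_inv_le_iff hs0] at this
  have hjen := hmean (‖a + b‖ₑ ^ (2 : ℝ)) (‖a - b‖ₑ ^ (2 : ℝ))
  rw [hpar, ← mul_assoc, ENNReal.inv_mul_cancel (by simp) (by simp), one_mul, ← hpow,
    ← hpow] at hjen
  have hsub := ENNReal.rpow_add_le_add_rpow (‖a‖ₑ ^ (2 : ℝ)) (‖b‖ₑ ^ (2 : ℝ)) hs0.le hs1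
  rw [← hpow, ← hpow] at hsub
  have := mul_le_mul_right (hjen.trans hsub) 2
  rwa [← mul_assoc, ENNReal.mul_inv_cancel (by simp) (by simp), one_mul] at this

/-! ### Random sums have large square function on a union of level sets. -/

section RandomSigns

variable {d : ℕ} {𝕜 : Type*} [RCLike 𝕜] {X : Type*} [AddAction (Fin d → ℤ) X] [MeasurableSpace X]
  [MeasurableConstVAdd (Fin d → ℤ) X] {μ : Measure X}
  (E : ℕ → Finset (Fin d → ℤ)) (N : ℕ)

/-- The additive group of measurable functions in `ℒ^p`. -/
def measurableMemLp (𝕜 : Type*) [RCLike 𝕜] (p : ℝ≥0∞) (μ : Measure X) : AddSubgroup (X → 𝕜) where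
  carrier := {f | Measurable f ∧ MemLp f p μ}
  add_mem' hf hg := ⟨hf.1.add hg.1, hf.2.add hg.2⟩
  zero_mem' := ⟨measurable_zero, MemLp.zero⟩
  neg_mem' hf := ⟨hf.1.neg, hf.2.neg⟩

/-- On the level set of the first function, one of its two signs succeeds for any choice of the
other signs, whence the factor `2`. Off that set, induction applies; `Y` is arbitrary so that it can
be split in this way. -/
theorem measure_inter_le_signAverage {p : ℝ≥0∞} (s : ℝ≥0∞) (l : List (measurableMemLp 𝕜 p μ))
    (h : measurableMemLp 𝕜 p μ) (Y : Set X) :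
    μ (Y ∩ ⋃ f ∈ l, {x | s < truncSquareFunction E N (f : X → 𝕜) x}) ≤
      2 * signAverage (fun h : measurableMemLp 𝕜 p μ =>
        μ (Y ∩ {x | s < truncSquareFunction E N (h : X → 𝕜) x})) l h := by
  induction l generalizing h Y with
  | nil => simp
  | cons f l ih =>
    set A : (X → 𝕜) → Set X := fun h => {x | s < truncSquareFunction E N h x} with hA
    have hAf : MeasurableSet (A f) :=
      measurableSet_lt measurable_const (measurable_truncSquareFunction E N f.2.1)
    have h1 : ∀ h : measurableMemLp 𝕜 p μ, μ (Y ∩ A f) ≤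
        μ (Y ∩ A f ∩ A (h + f : measurableMemLp 𝕜 p μ)) +
          μ (Y ∩ A f ∩ A (h - f : measurableMemLp 𝕜 p μ)) := by
      intro h
      refine le_trans (measure_mono fun x hx => ?_) (measure_union_le _ _)
      rw [← Set.inter_union_distrib_left]
      refine ⟨hx, ?_⟩
      by_contra hcon
      replace hcon : ¬(s < truncSquareFunction E N (h + f : X → 𝕜) x ∨
        s < truncSquareFunction E N (h - f : X → 𝕜) x) := hcon
      simp only [not_or, not_lt] at hcon
      have hx2 : s < truncSquareFunction E N (f : X → 𝕜) x := hx.2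
      have := (two_mul_truncSquareFunction_le E N (f : X → 𝕜) h x).trans
        (add_le_add hcon.1 hcon.2)
      rw [← two_mul, ENNReal.mul_le_mul_iff_right (by simp) (by simp)] at this
      exact absurd this (not_le.2 hx2)
    have h2 := le_signAverage_add_signAverage
      (Φ := fun h : measurableMemLp 𝕜 p μ => μ (Y ∩ A f ∩ A h)) h1 l h
    have h3 : ∀ h, μ (Y \ A f ∩ ⋃ f ∈ l, A f) ≤
        2 * signAverage (fun h : measurableMemLp 𝕜 p μ => μ (Y \ A f ∩ A h)) l h :=
      fun h => ih h (Y \ A f)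
    have h4 := signAverage_add_le (Φ := fun h : measurableMemLp 𝕜 p μ => μ (Y ∩ A f ∩ A h))
      (Ψ := fun h : measurableMemLp 𝕜 p μ => μ (Y \ A f ∩ A h))
      (Θ := fun h : measurableMemLp 𝕜 p μ => μ (Y ∩ A h))
      (fun h => by
        rw [Set.inter_right_comm, ← Set.inter_sdiff_right_comm]
        exact (measure_inter_add_sdiff _ hAf).le) l
    have h5 : μ (Y ∩ ⋃ g ∈ f :: l, A g) ≤ μ (Y ∩ A f) + μ (Y \ A f ∩ ⋃ f ∈ l, A f) := by
      refine le_trans (measure_mono fun x hx => ?_) (measure_union_le _ _)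
      obtain ⟨hxY, hx⟩ := hx
      simp only [List.mem_cons, Set.mem_iUnion, exists_prop] at hx
      by_cases hxf : x ∈ A f
      · exact Or.inl ⟨hxY, hxf⟩
      · obtain ⟨g, rfl | hg, hxg⟩ := hx
        · exact absurd hxg hxf
        · exact Or.inr ⟨⟨hxY, hxf⟩, Set.mem_biUnion hg hxg⟩
    refine h5.trans ?_
    simp only [signAverage]
    rw [ENNReal.mul_div_cancel (by simp) (by simp)]
    refine le_trans ?_ (add_le_add (h4 (h + f)) (h4 (h - f)))
    rw [add_add_add_comm]
    refine add_le_add h2 ?_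
    have := add_le_add (h3 (h + f)) (h3 (h - f))
    rw [← two_mul, ← mul_add, ENNReal.mul_le_mul_iff_right (by simp) (by simp)] at this
    exact this

theorem measure_inter_biUnion_le_of_forall {p : ℝ≥0∞} (hp : p ≠ 0) (hp2 : p ≤ 2) {s c : ℝ≥0∞}
    (H : ∀ f ∈ measurableMemLp 𝕜 p μ, μ {x | s < truncSquareFunction E N f x} ≤
      c + ∫⁻ x, ‖f x‖ₑ ^ p.toReal ∂μ) (l : List (measurableMemLp 𝕜 p μ)) (Y : Set X) :
    μ (Y ∩ ⋃ f ∈ l, {x | s < truncSquareFunction E N (f : X → 𝕜) x}) ≤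
      2 * (c + (l.map fun f : measurableMemLp 𝕜 p μ =>
        ∫⁻ x, ‖(f : X → 𝕜) x‖ₑ ^ p.toReal ∂μ).sum) := by
  have hptop : p ≠ ∞ := (hp2.trans_lt (by simp)).ne
  have hr : 0 < p.toReal := ENNReal.toReal_pos hp hptop
  have hr2 : p.toReal ≤ 2 := ENNReal.toReal_le_of_le_ofReal (by norm_num) (by simpa using hp2)
  refine (measure_inter_le_signAverage E N s l 0 Y).trans ?_
  gcongr
  refine (signAverage_le_of_type (c := c)
    (Φ := fun f : measurableMemLp 𝕜 p μ => ∫⁻ x, ‖(f : X → 𝕜) x‖ₑ ^ p.toReal ∂μ) ?_ ?_ l 0).trans ?_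
  · intro h f
    have hm : ∀ f : measurableMemLp 𝕜 p μ, Measurable fun x => ‖(f : X → 𝕜) x‖ₑ ^ p.toReal :=
      fun f => f.2.1.enorm.pow_const _
    rw [← lintegral_add_left (hm _), ← lintegral_add_left (hm _)]
    exact (lintegral_mono fun x => enorm_add_rpow_add_enorm_sub_rpow_le hr hr2 _ _).trans_eq
      (lintegral_const_mul _ ((hm h).add (hm f)))
  · exact fun h => (measure_mono Set.inter_subset_right).trans (H h h.2)
  · simp [ENNReal.zero_rpow_of_pos hr]

end RandomSigns

/-! ### Greedy covering by translates. -/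

section Covering

variable {X ι : Type*} [MeasurableSpace X] {μ : Measure X}

/-- If the sets `R v` cover `Y` at least `κ` times on average, then about `|V| / κ` of them
cover half of `Y`. -/
theorem exists_list_half_covered {V : Finset ι} (hV : V.Nonempty) {R : ι → Set X}
    (hR : ∀ v ∈ V, MeasurableSet (R v)) {Y : Set X} (hY : MeasurableSet Y) {κ : ℝ≥0∞}
    (hκ : ∀ U ⊆ Y, MeasurableSet U → κ * μ U ≤ ∑ v ∈ V, μ (U ∩ R v)) (J : ℕ) :
    ∃ l : List ι, l.length = J ∧ (∀ v ∈ l, v ∈ V) ∧ (μ Y ≤ 2 * μ (Y ∩ ⋃ v ∈ l, R v) ∨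
      J * (κ * μ Y) ≤ 2 * V.card * μ (Y ∩ ⋃ v ∈ l, R v)) := by
  induction J with
  | zero => exact ⟨[], rfl, by simp, Or.inr (by simp)⟩
  | succ J ih =>
    obtain ⟨l, hl, hlV, hcov⟩ := ih
    have hlm : MeasurableSet (⋃ v ∈ l, R v) :=
      MeasurableSet.biUnion (s := {v | v ∈ l}) (List.finite_toSet l).countable fun v hv => hR v (hlV v hv)
    have hmono : ∀ v, (⋃ v ∈ l, R v) ⊆ ⋃ w ∈ v :: l, R w := fun v =>
      Set.biUnion_subset_biUnion_left fun w hw => List.mem_cons_of_mem _ hw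
    by_cases hhalf : μ Y ≤ 2 * μ (Y ∩ ⋃ v ∈ l, R v)
    · obtain ⟨v, hv⟩ := hV
      refine ⟨v :: l, by simp [hl], by simpa [hv] using hlV, Or.inl (hhalf.trans ?_)⟩
      exact mul_le_mul_right (measure_mono (Set.inter_subset_inter_right Y (hmono v))) 2
    · replace hcov := hcov.resolve_left hhalf
      set U := Y \ ⋃ v ∈ l, R v with hU
      have hsplit : μ (Y ∩ ⋃ v ∈ l, R v) + μ U = μ Y := measure_inter_add_sdiff Y hlm
      have hUhalf : μ Y ≤ 2 * μ U := by
        by_contra hlt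
        have := ENNReal.add_lt_add (not_le.1 hhalf) (not_le.1 hlt)
        rw [← mul_add, hsplit, two_mul] at this
        exact lt_irrefl _ this
      -- Pigeonhole: some `v` does at least as well as the average on the uncovered part `U`, which
      -- still has at least half of the measure of `Y`.
      obtain ⟨v, hv, hvU⟩ : ∃ v ∈ V, κ * μ U ≤ V.card * μ (U ∩ R v) := by
        by_contra! hcon
        have h1 := ENNReal.sum_lt_sum_of_nonempty hV hcon
        rw [← Finset.mul_sum, Finset.sum_const, nsmul_eq_mul] at h1
        exact absurd h1 (not_lt.2 (mul_le_mul_right (hκ U Set.sdiff_subset (hY.diff hlm)) _))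
      refine ⟨v :: l, by simp [hl], by simpa [hv] using hlV, Or.inr ?_⟩
      have hgain : μ (Y ∩ ⋃ v ∈ l, R v) + μ (U ∩ R v) ≤ μ (Y ∩ ⋃ w ∈ v :: l, R w) := by
        rw [← measure_inter_add_sdiff (Y ∩ ⋃ w ∈ v :: l, R w) hlm]
        refine add_le_add (measure_mono fun x hx => ⟨⟨hx.1, hmono v hx.2⟩, hx.2⟩)
          (measure_mono fun x hx => ⟨⟨hx.1.1, ?_⟩, hx.1.2⟩)
        exact Set.mem_biUnion (List.mem_cons_self) hx.2
      calc ((J + 1 : ℕ) : ℝ≥0∞) * (κ * μ Y) = J * (κ * μ Y) + κ * μ Y := by push_cast; ring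
        _ ≤ 2 * V.card * μ (Y ∩ ⋃ v ∈ l, R v) + κ * (2 * μ U) := by gcongr
        _ = 2 * V.card * μ (Y ∩ ⋃ v ∈ l, R v) + 2 * (κ * μ U) := by ring
        _ ≤ 2 * V.card * μ (Y ∩ ⋃ v ∈ l, R v) + 2 * (V.card * μ (U ∩ R v)) := by gcongr
        _ = 2 * V.card * (μ (Y ∩ ⋃ v ∈ l, R v) + μ (U ∩ R v)) := by ring
        _ ≤ _ := by gcongr

end Covering

/-! ### Stein's principle: from a uniform estimate in measure to the weak type bound. -/

section SteinPrinciple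

variable {d : ℕ} {𝕜 : Type*} [RCLike 𝕜] {X : Type*} [AddAction (Fin d → ℤ) X] [MeasurableSpace X]
  [MeasurableConstVAdd (Fin d → ℤ) X] {μ : Measure X} [VAddInvariantMeasure (Fin d → ℤ) X μ]
  [IsProbabilityMeasure μ] {E : ℕ → Finset (Fin d → ℤ)}

omit [VAddInvariantMeasure (Fin d → ℤ) X μ] [IsProbabilityMeasure μ] in
/-- If each point of `towerSet B M` lies in many translates of a set containing `towerSet B P`, so
does every measurable subset on average. -/
theorem card_mul_measure_le_sum_of_towerSet {B A : Set X} (hA : MeasurableSet A)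
    {P M V : Finset (Fin d → ℤ)} (hPA : ∀ n ∈ P, ∀ b ∈ B, n +ᵥ b ∈ A)
    (hV : ∀ m ∈ M, ∀ n ∈ P, m - n ∈ V) {U : Set X} (hU : U ⊆ towerSet B M)
    (hUm : MeasurableSet U) :
    (P.card : ℝ≥0∞) * μ U ≤ ∑ v ∈ V, μ (U ∩ {x | -v +ᵥ x ∈ A}) := by
  classical
  have hm : ∀ v : Fin d → ℤ, MeasurableSet {x : X | -v +ᵥ x ∈ A} := fun v =>
    measurableSet_vadd_mem hA _
  have hpt : ∀ x, (P.card : ℝ≥0∞) * U.indicator 1 x ≤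
      ∑ v ∈ V, (U ∩ {x | -v +ᵥ x ∈ A}).indicator 1 x := by
    intro x
    by_cases hx : x ∈ U
    · obtain ⟨m, hm, hb⟩ := hU hx
      have h1 : ∀ n ∈ P, -(m - n) +ᵥ x ∈ A := fun n hn => by
        have := hPA n hn _ hb
        rwa [vadd_vadd, ← sub_eq_add_neg, ← neg_sub] at this
      -- The shifts `m - n`, for `n ∈ P`, are distinct elements of `V`, so `x` is covered at least
      -- `|P|` times.
      calc (P.card : ℝ≥0∞) * U.indicator 1 x = ∑ v ∈ P.image (m - ·), 1 := by
            rw [Set.indicator_of_mem hx, Finset.sum_const,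
              Finset.card_image_of_injective _ sub_right_injective]
            simp
        _ = ∑ v ∈ P.image (m - ·), (U ∩ {x | -v +ᵥ x ∈ A}).indicator 1 x := by
            refine Finset.sum_congr rfl fun v hv => ?_
            obtain ⟨n, hn, rfl⟩ := Finset.mem_image.1 hv
            rw [Set.indicator_of_mem (by exact ⟨hx, h1 n hn⟩), Pi.one_apply]
        _ ≤ _ := Finset.sum_le_sum_of_subset (Finset.image_subset_iff.2 fun n hn => hV m hm n hn)
    · simp [hx]
  have := lintegral_mono (μ := μ) hpt
  rw [lintegral_const_mul _ (measurable_one.indicator hUm), lintegral_indicator_one hUm,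
    lintegral_finsetSum _ fun v _ => measurable_one.indicator (hUm.inter (hm v))] at this
  refine this.trans_eq (Finset.sum_congr rfl fun v _ => ?_)
  exact lintegral_indicator_one (hUm.inter (hm v))

/-- With `c = (8 * 4 ^ d)⁻¹` and `G` the sum on the right, covering and random signs give `8c ≤ μ Y
≤ 4 (c + J μ(B) G)`, hence `c ≤ J μ(B) G`. Then `J |P| ≤ 2 |V|` and `|V| μ(B) ≤ 1` yield `c |P| ≤ 2
G`. -/
theorem card_le_of_forall_measure_le (hfree : IsFreeAction d μ) {p : ℝ≥0∞} (hp : p ≠ 0)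
    (hp2 : p ≤ 2) {s : ℝ≥0∞} {N : ℕ}
    (H : ∀ f ∈ measurableMemLp 𝕜 p μ, μ {x | s < truncSquareFunction E N f x} ≤
      (8 * 4 ^ d)⁻¹ + ∫⁻ x, ‖f x‖ₑ ^ p.toReal ∂μ)
    {g : (Fin d → ℤ) → 𝕜} {P W : Finset (Fin d → ℤ)} (hg : ∀ n ∉ W, g n = 0)
    (hP : ∀ n ∈ P, s < truncSquareFunction E N g n) :
    (P.card : ℝ≥0∞) ≤ 2 * (8 * 4 ^ d) * ∑ w ∈ W, ‖g w‖ₑ ^ p.toReal := by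
  classical
  have hptop : p ≠ ∞ := (hp2.trans_lt (by simp)).ne
  have hr : 0 < p.toReal := ENNReal.toReal_pos hp hptop
  rcases P.eq_empty_or_nonempty with rfl | hPne
  · simp
  set G : ℝ≥0∞ := ∑ w ∈ W, ‖g w‖ₑ ^ p.toReal with hG
  set c : ℝ≥0∞ := (8 * 4 ^ d)⁻¹ with hc
  have hc0 : (8 * 4 ^ d : ℝ≥0∞) ≠ 0 := by positivity
  have hctop : (8 * 4 ^ d : ℝ≥0∞) ≠ ∞ := by finiteness
  obtain ⟨R, hR⟩ := exists_subset_latticeBox (translationRange E N ∪ (P ∪ W))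
  have hH : ∀ y ∈ translationRange E N, y ∈ latticeBox d R := fun y hy => hR (by simp [hy])
  have hPR : ∀ n ∈ P, n ∈ latticeBox d R := fun y hy => hR (by simp [hy])
  have hWR : ∀ w ∈ W, w ∈ latticeBox d R := fun y hy => hR (by simp [hy])
  set V := latticeBox d (R + R)
  set M := latticeBox d R
  -- Radius `4R` contains all differences of elements of `V`, so the translates of the base over `V`
  -- are disjoint. It also gives `|D| ≤ 4 ^ d |M|`, the source of the constant.
  set D := latticeBox d (R + R + (R + R))
  have hVD : V ⊆ D := latticeBox_mono (by omega)
  obtain ⟨B, hB, hBs, hB1⟩ := hfree.exists_separatedBy_one_le (D := D)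
    (by simp [D, mem_latticeBox]) fun k hk => neg_mem_latticeBox hk
  set F := towerLift B W g with hF
  have hFm : Measurable F := measurable_towerLift hB
  have hFint : ∫⁻ x, ‖F x‖ₑ ^ p.toReal ∂μ ≤ μ B * G := hBs.lintegral_towerLift_le hB
    (fun w hw w' hw' => hVD (sub_mem_latticeBox (hWR w hw) (hWR w' hw'))) hr
  set A : Set X := {x | s < truncSquareFunction E N F x} with hA
  have hAm : MeasurableSet A :=
    measurableSet_lt measurable_const (measurable_truncSquareFunction E N hFm)
  have hPA : ∀ n ∈ P, ∀ b ∈ B, n +ᵥ b ∈ A := by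
    intro n hn b hb
    have := hBs.truncSquareFunction_towerLift E N hg (n := n) (fun y hy w hw =>
      latticeBox_mono (by omega) (sub_mem_latticeBox
        (add_mem_latticeBox (neg_mem_latticeBox (hH y hy)) (hPR n hn)) (hWR w hw))) hb
    exact (hP n hn).trans_eq this.symm
  set Y := towerSet B M with hYdef
  have hYm : MeasurableSet Y := measurableSet_towerSet hB M
  have hVne : V.Nonempty := ⟨0, by simp [V, mem_latticeBox]⟩
  have hPV : P.card ≤ V.card :=
    Finset.card_le_card fun n hn => latticeBox_mono (by omega) (hPR n hn)
  have hP0 : 0 < P.card := hPne.card_pos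
  set J := V.card / P.card + 1 with hJ
  have hJ1 : V.card ≤ J * P.card := by
    rw [hJ, mul_comm]; exact (Nat.lt_mul_div_succ _ hP0).le
  have hJ2 : J * P.card ≤ 2 * V.card := by
    have := Nat.div_mul_le_self V.card P.card
    rw [hJ, add_mul, one_mul]; omega
  obtain ⟨l, hlJ, hlV, hcov⟩ := exists_list_half_covered hVne
    (fun v _ => measurableSet_vadd_mem hAm (-v)) hYm (fun U hU hUm =>
      card_mul_measure_le_sum_of_towerSet (μ := μ) hAm hPA
        (fun m hm n hn => sub_mem_latticeBox hm (hPR n hn)) hU hUm) J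
  have hhalf : μ Y ≤ 2 * μ (Y ∩ ⋃ v ∈ l, {x | -v +ᵥ x ∈ A}) := by
    refine hcov.elim id fun h => ?_
    have hV0 : (V.card : ℝ≥0∞) ≠ 0 := by simpa using hVne.ne_empty
    rw [← ENNReal.mul_le_mul_iff_right hV0 (ENNReal.natCast_ne_top _)]
    calc (V.card : ℝ≥0∞) * μ Y ≤ (J * P.card : ℕ) * μ Y := by gcongr
      _ = J * (P.card * μ Y) := by push_cast; ring
      _ ≤ _ := h
      _ = _ := by ring
  have hFmem : ∀ v : Fin d → ℤ, (fun x => F (-v +ᵥ x)) ∈ measurableMemLp 𝕜 p μ := fun v =>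
    ⟨hFm.comp (measurable_const_vadd _),
      (memLp_towerLift hB p).comp_measurePreserving (measurePreserving_vadd (-v) μ)⟩
  have hsigns := measure_inter_biUnion_le_of_forall E N hp hp2 H
    (l.map fun v => (⟨_, hFmem v⟩ : measurableMemLp 𝕜 p μ)) Y
  have hFv : ∀ v : Fin d → ℤ, ∫⁻ x, ‖F (-v +ᵥ x)‖ₑ ^ p.toReal ∂μ = ∫⁻ x, ‖F x‖ₑ ^ p.toReal ∂μ :=
    fun v => (measurePreserving_vadd (-v) μ).lintegral_comp (hFm.enorm.pow_const _)
  have hunion : (⋃ f ∈ l.map fun v => (⟨_, hFmem v⟩ : measurableMemLp 𝕜 p μ),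
      {x | s < truncSquareFunction E N (f : X → 𝕜) x}) = ⋃ v ∈ l, {x | -v +ᵥ x ∈ A} := by
    ext x
    simp [hA, truncSquareFunction_comp_vadd]
  rw [hunion, List.map_map] at hsigns
  have hsum : (l.map ((fun f : measurableMemLp 𝕜 p μ => ∫⁻ x, ‖(f : X → 𝕜) x‖ₑ ^ p.toReal ∂μ) ∘
      fun v => (⟨_, hFmem v⟩ : measurableMemLp 𝕜 p μ))).sum = J * ∫⁻ x, ‖F x‖ₑ ^ p.toReal ∂μ := by
    simp [Function.comp_def, hFv, hlJ]
  rw [hsum] at hsigns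
  have hYbig : 8 * c ≤ μ Y := by
    have hMD : D.card ≤ 4 ^ d * M.card := by
      rw [card_latticeBox, card_latticeBox, ← mul_pow]
      exact Nat.pow_le_pow_left (by omega) _
    have hYM : μ Y = M.card * μ B := hBs.measure_towerSet hB fun m hm n hn =>
      hVD (sub_mem_latticeBox hm hn)
    have h8 : 8 * c = (4 ^ d)⁻¹ := by
      rw [hc, ENNReal.mul_inv (by simp) (by simp), ← mul_assoc,
        ENNReal.mul_inv_cancel (by simp) (by simp), one_mul]
    rw [h8, hYM, ENNReal.inv_le_iff_le_mul (by simp) (by simp), ← mul_assoc]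
    refine hB1.trans ?_
    gcongr
    exact_mod_cast hMD
  have hcle : c ≤ J * (μ B * G) := by
    have h1 : 4 * c + 4 * c ≤ 4 * c + 4 * (J * (μ B * G)) := by
      calc 4 * c + 4 * c = 8 * c := by ring
        _ ≤ μ Y := hYbig
        _ ≤ 2 * (2 * (c + J * ∫⁻ x, ‖F x‖ₑ ^ p.toReal ∂μ)) := hhalf.trans (by gcongr)
        _ = 4 * c + 4 * (J * ∫⁻ x, ‖F x‖ₑ ^ p.toReal ∂μ) := by ring
        _ ≤ _ := by gcongr
    have hcfin : 4 * c ≠ ∞ := by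
      rw [hc]; exact ENNReal.mul_ne_top (by simp) (ENNReal.inv_ne_top.2 hc0)
    rw [ENNReal.add_le_add_iff_left hcfin, ENNReal.mul_le_mul_iff_right (by simp) (by simp)] at h1
    exact h1
  have hVB : V.card * μ B ≤ 1 := by
    rw [← hBs.measure_towerSet hB fun m hm n hn => sub_mem_latticeBox hm hn]
    exact prob_le_one
  have hfinal : c * P.card ≤ 2 * G := by
    calc c * P.card ≤ J * (μ B * G) * P.card := by gcongr
      _ = (J * P.card : ℕ) * (μ B * G) := by push_cast; ring
      _ ≤ (2 * V.card : ℕ) * (μ B * G) := by gcongr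
      _ = (V.card * μ B) * (2 * G) := by push_cast; ring
      _ ≤ 1 * (2 * G) := by gcongr
      _ = _ := one_mul _
  rw [hc, mul_comm, ← div_eq_mul_inv, ENNReal.div_le_iff hc0 hctop] at hfinal
  exact hfinal.trans_eq (by ring)

theorem exists_latticeWeakBound_of_ae_lt_top (hfree : IsFreeAction d μ) {p : ℝ≥0∞} (hp : 1 ≤ p)
    (hp2 : p ≤ 2)
    (h : ∀ f : X → 𝕜, MemLp f p μ → ∀ᵐ x ∂μ, ergodicSquareFunction E f x < ∞) :
    ∃ C : ℝ≥0, LatticeWeakBound 𝕜 E p.toReal ((C : ℝ≥0∞) ^ p.toReal) := by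
  have hp0 : p ≠ 0 := (zero_lt_one.trans_le hp).ne'
  have hptop : p ≠ ∞ := (hp2.trans_lt (by simp)).ne
  have hr : 0 < p.toReal := ENNReal.toReal_pos hp0 hptop
  obtain ⟨K, hK⟩ := exists_forall_measure_lt_ergodicSquareFunction_le E hp h
    (c := (8 * 4 ^ d)⁻¹) (ENNReal.inv_ne_zero.2 (by finiteness))
  -- Banach's principle covers integrals at most `1`; beyond that the bound is trivial in a
  -- probability space. Using `K + 1` in place of `K` keeps the threshold positive for the rescaling
  -- below.
  have H : ∀ N, ∀ f ∈ measurableMemLp 𝕜 p μ,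
      μ {x | ((K + 1 : ℝ≥0) : ℝ≥0∞) < truncSquareFunction E N f x} ≤
        (8 * 4 ^ d)⁻¹ + ∫⁻ x, ‖f x‖ₑ ^ p.toReal ∂μ := by
    intro N f hf
    by_cases h1 : ∫⁻ x, ‖f x‖ₑ ^ p.toReal ∂μ ≤ 1
    · refine le_add_right (le_trans (measure_mono fun x hx => ?_) (hK f hf.2 ?_))
      · refine (lt_ergodicSquareFunction_iff E f x).2 ⟨N, lt_of_le_of_lt ?_ hx⟩
        exact_mod_cast (le_add_right le_rfl : K ≤ K + 1)
      · rw [eLpNorm_eq_lintegral_rpow_enorm_toReal hp0 hptop]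
        exact ENNReal.rpow_le_one h1 (by positivity)
    · exact le_add_left (prob_le_one.trans (not_le.1 h1).le)
  set C₁ : ℝ≥0 := 2 * (8 * 4 ^ d) * (K + 1) ^ p.toReal with hC₁
  have hpow : ((C₁ ^ (1 / p.toReal) : ℝ≥0) : ℝ≥0∞) ^ p.toReal = C₁ := by
    rw [← ENNReal.coe_rpow_of_nonneg _ hr.le, ← NNReal.rpow_mul, one_div_mul_cancel hr.ne',
      NNReal.rpow_one]
  refine ⟨C₁ ^ (1 / p.toReal), fun N g t P W hg hP => ?_⟩
  rw [hpow]
  rcases eq_or_ne t 0 with rfl | ht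
  · simp [ENNReal.zero_rpow_of_pos hr]
  set a : ℝ≥0 := (K + 1) / t with ha
  have hnorm : ‖((a : ℝ) : 𝕜)‖ₑ = a := by
    rw [← ofReal_norm, RCLike.norm_ofReal, abs_of_nonneg a.coe_nonneg, ENNReal.ofReal_coe_nnreal]
  have hat : (a : ℝ≥0∞) * t = (K + 1 : ℝ≥0) := by
    rw [← ENNReal.coe_mul, ha, div_mul_cancel₀ _ ht]
  have ha0 : a ≠ 0 := div_ne_zero (by positivity) ht
  have hmain := card_le_of_forall_measure_le hfree hp0 hp2 (H N)
    (g := ((a : ℝ) : 𝕜) • g) (P := P) (W := W) (fun n hn => by simp [hg n hn]) fun n hn => by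
      rw [truncSquareFunction_smul, hnorm, ← hat]
      exact (ENNReal.mul_lt_mul_iff_right (by simpa using ha0) ENNReal.coe_ne_top).2 (hP n hn)
  simp only [Pi.smul_apply, smul_eq_mul, enorm_mul, hnorm, ENNReal.mul_rpow_of_nonneg _ _ hr.le,
    ← Finset.mul_sum] at hmain
  calc (t : ℝ≥0∞) ^ p.toReal * P.card ≤ (t : ℝ≥0∞) ^ p.toReal *
        (2 * (8 * 4 ^ d) * ((a : ℝ≥0∞) ^ p.toReal * ∑ w ∈ W, ‖g w‖ₑ ^ p.toReal)) := by gcongr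
    _ = 2 * (8 * 4 ^ d) * ((a : ℝ≥0∞) * t) ^ p.toReal * ∑ w ∈ W, ‖g w‖ₑ ^ p.toReal := by
      rw [ENNReal.mul_rpow_of_nonneg _ _ hr.le]; ring
    _ = _ := by
      rw [hat, hC₁, ← ENNReal.coe_rpow_of_nonneg _ hr.le]
      push_cast
      ring

end SteinPrinciple

/-- The set where `S f` is infinite lies in every level set, so `t ^ p` times its measure stays
bounded as `t` grows. -/
theorem HasWeakTypeBound.ae_lt_top {X 𝕜 : Type*} [RCLike 𝕜] [MeasurableSpace X] {μ : Measure X}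
    {S : (X → 𝕜) → X → ℝ≥0∞} {p : ℝ≥0∞} (hp : p ≠ 0) (hp' : p ≠ ∞) {C : ℝ≥0}
    (h : HasWeakTypeBound S p μ C) {f : X → 𝕜} (hf : MemLp f p μ) : ∀ᵐ x ∂μ, S f x < ∞ := by
  rw [hasWeakTypeBound_iff hp hp'] at h
  have hr : 0 < p.toReal := ENNReal.toReal_pos hp hp'
  set I := (C : ℝ≥0∞) ^ p.toReal * ∫⁻ x, ‖f x‖ₑ ^ p.toReal ∂μ with hI
  have hIfin : I ≠ ∞ := ENNReal.mul_ne_top (ENNReal.rpow_ne_top_of_nonneg hr.le ENNReal.coe_ne_top)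
    (lintegral_rpow_enorm_lt_top_of_eLpNorm_lt_top hp hp' hf.2).ne
  rw [ae_iff]
  by_contra hne
  set m := μ {x | ¬S f x < ∞} with hm
  have key : ∀ t : ℝ≥0, (t : ℝ≥0∞) ^ p.toReal * m ≤ I := by
    intro t
    refine le_trans ?_ (h f hf t)
    gcongr
    refine measure_mono fun x hx => ?_
    have hx' : S f x = ∞ := not_lt_top_iff.1 hx
    rw [Set.mem_ofPred_eq, hx']
    exact ENNReal.coe_lt_top
  obtain ⟨k, hk⟩ := ENNReal.exists_nat_mul_gt hne hIfin
  have := key ((k : ℝ≥0) ^ (1 / p.toReal))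
  rw [← ENNReal.coe_rpow_of_nonneg _ hr.le, ← NNReal.rpow_mul, one_div_mul_cancel hr.ne',
    NNReal.rpow_one] at this
  exact absurd this (not_le.2 (by exact_mod_cast hk))

theorem mainTheorem4 {𝕜 : Type*} [RCLike 𝕜] {d : ℕ} {X : Type*} [MeasurableSpace X]
    (μ : Measure X) [IsProbabilityMeasure μ] (hμ : IsNonatomicMeasure μ)
    [AddAction (Fin d → ℤ) X] [MeasurableConstVAdd (Fin d → ℤ) X]
    [VAddInvariantMeasure (Fin d → ℤ) X μ] (hfree : IsFreeAction d μ)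
    (E : ℕ → Finset (Fin d → ℤ)) (hE : ∀ m, (E m).Nonempty) :
    (∀ p : ℝ≥0∞, 1 ≤ p → p ≤ 2 →
      ((∀ f : X → 𝕜, MemLp f p μ → ∀ᵐ x ∂μ, ergodicSquareFunction E f x < ∞) ↔
        ∃ C : ℝ≥0, HasWeakTypeBound (𝕜 := 𝕜) (ergodicSquareFunction E) p μ C)) ∧
    (∀ C : ℝ≥0, HasWeakTypeBound (𝕜 := 𝕜) (ergodicSquareFunction E) 1 μ C ↔
      HasWeakTypeBound (𝕜 := 𝕜) (latticeSquareFunction E) 1 Measure.count C) := by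
  refine ⟨fun p hp hp2 => ?_, fun C => ?_⟩
  · have hp0 : p ≠ 0 := (zero_lt_one.trans_le hp).ne'
    have hptop : p ≠ ∞ := (hp2.trans_lt (by simp)).ne
    refine ⟨fun h => ?_, fun ⟨C, hC⟩ f hf => hC.ae_lt_top hp0 hptop hf⟩
    obtain ⟨C, hC⟩ := exists_latticeWeakBound_of_ae_lt_top hfree hp hp2 h
    exact ⟨C, hC.hasWeakTypeBound hp0 hptop⟩
  · rw [← latticeWeakBound_iff E one_ne_zero ENNReal.one_ne_top C]
    exact ⟨fun h => h.latticeWeakBound hfree one_ne_zero ENNReal.one_ne_top,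
      fun h => h.hasWeakTypeBound one_ne_zero ENNReal.one_ne_top⟩
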